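/- **Conventions.** Let $1/q$ be a prime power, $\Bbbk := \mathbb{F}_{1/q}$ the field with $1/q$ elements, and let $\alpha = (\alpha_1,\dots,\alpha_k)$ be a weak composition of $n$ (a sequence of nonnegative integers with sum $n$). For a partition $\lambda$ or a weak composition $\alpha$ put $n(\lambda) := \sum_i \binom{\lambda_i}{2}$ and $n(\alpha) := \sum_i \binom{\alpha_i}{2}$. Put $[m]_q := 1+q+\cdots+q^{m-1}$, $[m]_q! := [m]_q\cdots[1]_q$ and $\binom{a}{b}_q := \frac{[a]_q!}{[b]_q!\,[a-b]_q!}$ for $0 \le b \le a$. *Tableaux.* $\mathrm{SSYT}(\lambda)$ is the set of semistandard Young tableaux $T$ of shape $\lambda$ with positive integer entries, and $\mathrm{SSYT}(\lambda,\alpha)$ is the subset of those in which each $i$ occurs exactly $\alpha_i$ times (with $\alpha_i := 0$ for $i > k$). Let $T^{(j)}$ be the partition formed by the boxes of $T$ with entries in $\{1,\dots,j\}$, and define $$\mathrm{wt}_q(T) := \prod_{i,j\ge 1}\binom{T^{(j)}_i - T^{(j)}_{i+1}}{T^{(j)}_i - T^{(j-1)}_i}_q, \qquad W_\lambda(\mathbf{x};q)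 := \sum_{T\in\mathrm{SSYT}(\lambda)}\mathrm{wt}_q(T)\prod_{i\ge 1}x_i^{\#\{i\text{'s in }T\}},$$ the latter being the $q$-Whittaker function, a formal power series in $x_1,x_2,\dots$; $[\mathbf{x}^\alpha]$ denotes extraction of the coefficient of $x_1^{\alpha_1}\cdots x_k^{\alpha_k}$. *Jordan forms.* For a nilpotent endomorphism $N$ of a finite-dimensional vector space, let $\mathrm{JF}(N)$ be the conjugate of the partition formed by the sizes of the Jordan blocks of $N$. *The quiver variety.* Let $\mathrm{Fl}_\alpha$ be the set of partial flags $F = (F_0\subseteq F_1\subseteq\cdots\subseteq F_k)$ of subspaces of $\Bbbk^n$ with $\dim F_i = \alpha_1+\cdots+\alpha_i$ for $0\le i\le k$. An endomorphism $N$ of $\Bbbk^n$ is strictly compatible with $F$ if $N(F_i)\subseteq F_{i-1}$ for $1\le i\le k$; then $N$ is nilpotent. For such a pair, $V_{F,N}$ is the representation of the double of the path quiver $k-1\to k-2\to\cdots\to 1\to 0$ with the space $F_{k-i}$ at vertex $i$ (so $\Bbbk^n$ at vertex $0$), each arrow acting as the inclusion and each reversed arrow acting as $N$. The type-$A$ Nakajima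 quiver variety $\mathfrak{M}_\alpha$ is the set of all such representations $V_{F,N}$. For $T\in\mathrm{SSYT}(\lambda,\alpha)$, let $\mathfrak{M}_\alpha^T\subseteq\mathfrak{M}_\alpha$ be the set of those $V_{F,N}$ for which $T^{(i)} = \mathrm{JF}(N|_{F_i})$ for all $1\le i\le k$. **Theorem 8.6.** (i) For every partition $\lambda$ and every $T\in\mathrm{SSYT}(\lambda,\alpha)$, $$|\mathfrak{M}_\alpha^T| = \frac{q^{-n^2+n+n(\lambda)+n(\alpha)}(1-q)^{n-\lambda_1}[n]_q!}{\prod_{i\ge 1}[\lambda_i-\lambda_{i+1}]_q!}\,\mathrm{wt}_q(T).$$ (ii) We have $$|\mathfrak{M}_\alpha| = \sum_{\lambda\vdash n}\frac{q^{-n^2+n+n(\lambda)+n(\alpha)}(1-q)^{n-\lambda_1}[n]_q!}{\prod_{i\ge 1}[\lambda_i-\lambda_{i+1}]_q!}\,[\mathbf{x}^\alpha]W_\lambda(\mathbf{x};q).$$ -/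

import Mathlib

namespace QWhittaker

/-! ### Partitions and tableaux

A partition is a `YoungDiagram`; `μ.rowLen i` is its part `μ_{i+1}`, and `μ.colLen 0` is its number
of nonzero parts. A semistandard tableau is Mathlib's `SemistandardYoungTableau`, whose entries are
natural numbers: the entry `e` plays the role of the positive integer `e + 1`. Likewise the
variable `x_{i+1}` is the variable with index `i`, and a weak composition `(α_1, …, α_k)` is a
function `α : Fin k → ℕ` with `α i` playing the role of `α_{i+1}`. -/

theorem finite_setOf_card_eq (n : ℕ) : {μ : YoungDiagram | μ.card = n}.Finite := by
  have hinj : Set.InjOn YoungDiagram.cells {μ : YoungDiagram | μ.card = n} := by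
    intro μ _ ν _ h
    exact YoungDiagram.ext h
  refine Set.Finite.of_finite_image (f := YoungDiagram.cells) ?_ hinj
  refine (Finset.finite_toSet (Finset.range n ×ˢ Finset.range n).powerset).subset ?_
  rintro _ ⟨μ, hμ, rfl⟩
  simp only [Finset.coe_powerset, Set.mem_preimage, Set.mem_powerset_iff, Finset.coe_subset]
  rintro ⟨i, j⟩ hc
  rw [YoungDiagram.mem_cells] at hc
  have hcard : μ.cells.card = n := hμ
  have h1 : i < μ.colLen j := YoungDiagram.mem_iff_lt_colLen.mp hc
  have h2 : j < μ.rowLen i := YoungDiagram.mem_iff_lt_rowLen.mp hc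
  have h3 : μ.colLen j ≤ n := by
    rw [YoungDiagram.colLen_eq_card, ← hcard]
    exact Finset.card_le_card (Finset.filter_subset _ _)
  have h4 : μ.rowLen i ≤ n := by
    rw [YoungDiagram.rowLen_eq_card, ← hcard]
    exact Finset.card_le_card (Finset.filter_subset _ _)
  simp only [Finset.mem_product, Finset.mem_range]
  omega

/-- The finite set of all partitions of `n`. -/
noncomputable def partitionsOf (n : ℕ) : Finset YoungDiagram :=
  (finite_setOf_card_eq n).toFinset

/-- The statistic `∑ i, (μ_i choose 2)` of a partition. -/
def nStat (μ : YoungDiagram) : ℕ :=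
  ∑ i ∈ Finset.range (μ.colLen 0), (μ.rowLen i).choose 2

/-- The statistic `∑ i, (α_i choose 2)` of a weak composition. -/
def nStatComp {k : ℕ} (α : Fin k → ℕ) : ℕ :=
  ∑ i, (α i).choose 2

/-- The weak composition `(α_1, …, α_k)` as the exponent vector of the monomial `x^α`. -/
noncomputable def compExponent {k : ℕ} (α : Fin k → ℕ) : ℕ →₀ ℕ :=
  ∑ i : Fin k, Finsupp.single (i : ℕ) (α i)

/-- The content of a tableau: its value at `e` is the number of cells with entry `e`. -/
noncomputable def content {μ : YoungDiagram} (T : SemistandardYoungTableau μ) : ℕ →₀ ℕ :=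
  ∑ c ∈ μ.cells, Finsupp.single (T c.1 c.2) 1

theorem finite_setOf_content_eq (μ : YoungDiagram) (m : ℕ →₀ ℕ) :
    {T : SemistandardYoungTableau μ | content T = m}.Finite := by
  have hinj : Function.Injective
      (fun (T : SemistandardYoungTableau μ) (c : μ.cells) => T c.1.1 c.1.2) := by
    intro T T' h
    ext i j
    by_cases hc : (i, j) ∈ μ
    · exact congrFun h ⟨(i, j), hc⟩
    · rw [T.zeros hc, T'.zeros hc]
  refine Set.Finite.of_finite_image
    (f := fun (T : SemistandardYoungTableau μ) (c : μ.cells) => T c.1.1 c.1.2) ?_ hinj.injOn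
  refine (Set.Finite.pi' (fun _ : μ.cells => m.support.finite_toSet)).subset ?_
  rintro _ ⟨T, hT, rfl⟩ ⟨c, hc⟩
  have hT' : content T = m := hT
  simp only [Finset.mem_coe, Finsupp.mem_support_iff]
  rw [← hT', content, Finsupp.finsetSum_apply]
  refine (Finset.sum_pos' (fun _ _ => Nat.zero_le _) ⟨c, hc, ?_⟩).ne'
  simp

/-- The partition `T^(j)` formed by the cells of `T` containing one of the `j` smallest possible
entries (the entries `1, …, j` when entries are numbered from `1`, that is `0, …, j - 1` here). -/
def subshape {μ : YoungDiagram} (T : SemistandardYoungTableau μ) (j : ℕ) : YoungDiagram where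
  cells := μ.cells.filter (fun c => T c.1 c.2 < j)
  isLowerSet := by
    rintro ⟨i₁, j₁⟩ ⟨i₂, j₂⟩ hle hc
    obtain ⟨hi, hj⟩ := Prod.mk_le_mk.mp hle
    simp only [Finset.coe_filter, Set.mem_ofPred_eq, YoungDiagram.mem_cells] at hc ⊢
    refine ⟨μ.up_left_mem hi hj hc.1, lt_of_le_of_lt ?_ hc.2⟩
    exact (T.row_weak_of_le hj (μ.up_left_mem hi le_rfl hc.1)).trans (T.col_weak hi hc.1)

/-! ### `q`-analogues and `q`-Whittaker functions -/

/-- The `q`-factorial `[n]_q! = [n]_q ⋯ [1]_q`, where `[m]_q = 1 + q + ⋯ + q ^ (m - 1)`. -/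
noncomputable def qFactorial (q : ℝ) (n : ℕ) : ℝ :=
  ∏ m ∈ Finset.range n, ∑ i ∈ Finset.range (m + 1), q ^ i

/-- The `q`-binomial coefficient; it is only ever used for `b ≤ a`. -/
noncomputable def qBinomial (q : ℝ) (a b : ℕ) : ℝ :=
  qFactorial q a / (qFactorial q b * qFactorial q (a - b))

/-- The `q`-weight
`wt_q(T) = ∏_{i, j ≥ 1} [T^(j)_i - T^(j)_{i+1} choose T^(j)_i - T^(j-1)_i]_q`.
The product is over all rows of `T` and all values up to the largest entry of `T`; all other
factors of the infinite product are of the form `[a choose 0]_q = 1`. -/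
noncomputable def qWeight (q : ℝ) {μ : YoungDiagram} (T : SemistandardYoungTableau μ) : ℝ :=
  ∏ i ∈ Finset.range (μ.colLen 0), ∏ j ∈ Finset.range (μ.cells.sup (fun c => T c.1 c.2) + 1),
    qBinomial q ((subshape T (j + 1)).rowLen i - (subshape T (j + 1)).rowLen (i + 1))
      ((subshape T (j + 1)).rowLen i - (subshape T j).rowLen i)

/-- The `q`-Whittaker function `W_μ(x; q) = ∑ T, wt_q(T) x^T`, the sum being over all semistandard
tableaux of shape `μ`, as a formal power series: the coefficient of `x^m` is the sum of `wt_q(T)`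
over the finitely many `T` with content `m`. -/
noncomputable def qWhittaker (q : ℝ) (μ : YoungDiagram) : MvPowerSeries ℕ ℝ :=
  fun m => ∑ T ∈ (finite_setOf_content_eq μ m).toFinset, qWeight q T

/-- The factor
`q^(-n² + n + n(μ) + n(α)) (1 - q)^(n - μ_1) [n]_q! / ∏_{i ≥ 1} [μ_i - μ_{i+1}]_q!`. -/
noncomputable def prefactor (q : ℝ) (n : ℕ) {k : ℕ} (α : Fin k → ℕ) (μ : YoungDiagram) : ℝ :=
  q ^ (-(n : ℤ) ^ 2 + n + nStat μ + nStatComp α) * (1 - q) ^ ((n : ℤ) - μ.rowLen 0)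
    * qFactorial q n
    / ∏ i ∈ Finset.range (μ.colLen 0), qFactorial q (μ.rowLen i - μ.rowLen (i + 1))

/-! ### Jordan forms -/

/-- The nilpotent Jordan block of size `m`. -/
def jordanBlock (𝕜 : Type*) [Field 𝕜] (m : ℕ) : Matrix (Fin m) (Fin m) 𝕜 :=
  Matrix.of fun i j => if (i : ℕ) + 1 = j then 1 else 0

/-- The block-diagonal matrix with one nilpotent Jordan block of size `ν_i` for each part `ν_i`. -/
def jordanMatrix (𝕜 : Type*) [Field 𝕜] (ν : YoungDiagram) :
    Matrix ((i : Fin (ν.colLen 0)) × Fin (ν.rowLen i))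
      ((i : Fin (ν.colLen 0)) × Fin (ν.rowLen i)) 𝕜 :=
  Matrix.blockDiagonal' fun i : Fin (ν.colLen 0) => jordanBlock 𝕜 (ν.rowLen i)

/-- `JF(N) = μ`: the endomorphism `N` is nilpotent and its (conjugated) Jordan form partition is
`μ`, i.e. in some basis `N` is given by the nilpotent Jordan matrix whose block sizes are the parts
of the conjugate partition of `μ`. -/
def HasJordanType {𝕜 V : Type*} [Field 𝕜] [AddCommGroup V] [Module 𝕜 V]
    (N : Module.End 𝕜 V) (μ : YoungDiagram) : Prop :=
  ∃ b : Module.Basis ((i : Fin (μ.transpose.colLen 0)) × Fin (μ.transpose.rowLen i)) 𝕜 V,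
    LinearMap.toMatrix b b N = jordanMatrix 𝕜 μ.transpose

/-! ### Partial flags -/

/-- Partial flags `F_0 ⊆ F_1 ⊆ ⋯ ⊆ F_k` in `𝕜^n` with `dim F_i = α_1 + ⋯ + α_i`. -/
@[ext]
structure PartialFlag (𝕜 : Type*) [Field 𝕜] (n : ℕ) {k : ℕ} (α : Fin k → ℕ) where
  space : Fin (k + 1) → Submodule 𝕜 (Fin n → 𝕜)
  mono : Monotone space
  finrank_space : ∀ i, Module.finrank 𝕜 (space i) =
    ∑ j ∈ Finset.univ.filter (fun j : Fin k => (j : ℕ) < i), α j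

/-- `N F_i ⊆ F_{i-1}` for `1 ≤ i ≤ k`. -/
def StrictlyCompatible {𝕜 : Type*} [Field 𝕜] {n k : ℕ} {α : Fin k → ℕ}
    (F : PartialFlag 𝕜 n α) (N : Module.End 𝕜 (Fin n → 𝕜)) : Prop :=
  ∀ i : Fin k, ∀ v ∈ F.space i.succ, N v ∈ F.space i.castSucc

theorem StrictlyCompatible.mapsTo {𝕜 : Type*} [Field 𝕜] {n k : ℕ} {α : Fin k → ℕ}
    {F : PartialFlag 𝕜 n α} {N : Module.End 𝕜 (Fin n → 𝕜)} (h : StrictlyCompatible F N)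
    (i : Fin k) : ∀ v ∈ F.space i.succ, N v ∈ F.space i.succ :=
  fun v hv => F.mono (Fin.castSucc_lt_succ (i := i)).le (h i v hv)

/-- `JF(N; F) = T`: for `1 ≤ i ≤ k`, the partition `T^(i)` is the (conjugated) Jordan form
partition of the restriction of `N` to `F_i`. -/
def HasJordanTableau {𝕜 : Type*} [Field 𝕜] {n k : ℕ} {α : Fin k → ℕ}
    {F : PartialFlag 𝕜 n α} {N : Module.End 𝕜 (Fin n → 𝕜)} (h : StrictlyCompatible F N)
    {μ : YoungDiagram} (T : SemistandardYoungTableau μ) : Prop :=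
  ∀ i : Fin k, HasJordanType (N.restrict (h.mapsTo i)) (subshape T (i + 1))

/-! ### The quiver variety -/

/-- Representations, on subspaces of `𝕜^n`, of the double of the path quiver
`k - 1 → k - 2 → ⋯ → 1 → 0`: a subspace for every vertex, a linear map for every arrow
`i → j` (where `i = j + 1`), and a linear map for the reverse of every arrow. -/
structure DoublePathRep (𝕜 : Type*) [Field 𝕜] (n k : ℕ) where
  space : Fin k → Submodule 𝕜 (Fin n → 𝕜)
  arrow : ∀ i j : Fin k, (i : ℕ) = j + 1 → (space i →ₗ[𝕜] space j)
  revArrow : ∀ i j : Fin k, (i : ℕ) = j + 1 → (space j →ₗ[𝕜] space i)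

/-- The index `k - i` of the flag subspace placed at vertex `i`. -/
def flagIndex {k : ℕ} (i : Fin k) : Fin (k + 1) := ⟨k - i, by omega⟩

theorem flagIndex_le {k : ℕ} {i j : Fin k} (hij : (i : ℕ) = j + 1) :
    flagIndex i ≤ flagIndex j := by
  simp only [flagIndex, Fin.mk_le_mk]
  omega

theorem StrictlyCompatible.mapsTo_flagIndex {𝕜 : Type*} [Field 𝕜] {n k : ℕ} {α : Fin k → ℕ}
    {F : PartialFlag 𝕜 n α} {N : Module.End 𝕜 (Fin n → 𝕜)} (h : StrictlyCompatible F N)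
    {i j : Fin k} (hij : (i : ℕ) = j + 1) :
    ∀ v ∈ F.space (flagIndex j), N v ∈ F.space (flagIndex i) := by
  intro v hv
  have hi := i.isLt
  have h1 : flagIndex j = (⟨k - i, by omega⟩ : Fin k).succ := by
    ext
    simp only [flagIndex, Fin.val_succ]
    omega
  rw [h1] at hv
  exact h _ v hv

/-- The representation `V_{F,N}`: the space `F_{k-i}` at vertex `i` (so `𝕜^n` at vertex `0`), with
every arrow acting as the inclusion and every reverse arrow acting as `N`. -/
def quiverPoint {𝕜 : Type*} [Field 𝕜] {n k : ℕ} {α : Fin k → ℕ}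
    (F : PartialFlag 𝕜 n α) (N : Module.End 𝕜 (Fin n → 𝕜)) (h : StrictlyCompatible F N) :
    DoublePathRep 𝕜 n k where
  space i := F.space (flagIndex i)
  arrow _ _ hij := Submodule.inclusion (F.mono (flagIndex_le hij))
  revArrow _ _ hij := LinearMap.restrict N (h.mapsTo_flagIndex hij)

/-- The Nakajima quiver variety `𝔐_α`: the set of all `V_{F,N}`. -/
def quiverVariety (𝕜 : Type*) [Field 𝕜] (n : ℕ) {k : ℕ} (α : Fin k → ℕ) :
    Set (DoublePathRep 𝕜 n k) :=
  {V | ∃ (F : PartialFlag 𝕜 n α) (N : Module.End 𝕜 (Fin n → 𝕜)) (h : StrictlyCompatible F N),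
    V = quiverPoint F N h}

/-- The subset `𝔐_α^T` of all `V_{F,N}` with `JF(N; F) = T`. -/
def quiverVarietyTableau (𝕜 : Type*) [Field 𝕜] (n : ℕ) {k : ℕ} (α : Fin k → ℕ)
    {μ : YoungDiagram} (T : SemistandardYoungTableau μ) : Set (DoublePathRep 𝕜 n k) :=
  {V | ∃ (F : PartialFlag 𝕜 n α) (N : Module.End 𝕜 (Fin n → 𝕜)) (h : StrictlyCompatible F N),
    V = quiverPoint F N h ∧ HasJordanTableau h T}

end QWhittaker

/-! A point V_{F,N} determines the pair (F, N) (`quiverPoint_injective`), so the task is to count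
pairs. Put Q = 1/q. The number of flags is a Q-multinomial coefficient (`natCard_partialFlag`), and
for a fixed flag the number of N with prescribed types on all steps turns out not to depend on the
flag.

That number is found by extending N one step at a time. Let W = F_j carry N with type μ, and write
F_{j+1} = W ⊕ C. An extension is a linear map f : C → W, and the kernel of the (i+1)-st power grows
by dim f⁻¹(G_i), where G_i = N W + (W ∩ ker N^i) (`finrank_inf_ker_pow_succ`). The G_i form a flag
with dim G_i = |μ| - μ_{i+1} (`finrank_extensionFlag_add`). The new type λ thus prescribes the
dimensions of the preimages of a flag under f, and such maps are counted by choosing the preimages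
and then injections modulo the previous step (`natCard_flagged_linearMap`). The result,
`extensionCount`, depends only on μ and λ.

Rewritten in q, `extensionCount` is a ratio of values of `typeFactor` at λ and μ, times [|λ| -
|μ|]_q! and the weight of the strip λ/μ (`extensionCount_mul_typeFactor`). Along the chain T^(0),
T^(1), … the ratios telescope, the strip weights multiply to wt_q(T), and the factorials cancel the
denominator of the flag count. This is (i).

For (ii), each compatible pair has exactly one tableau. The rows of the type of N on U are the
dimensions of the layers N^s(U ∩ ker N^(s+1)), and N F_{i+1} ⊆ F_i makes the layers of consecutive
steps interlace, so the types form a chain of horizontal strips. The link with Jordan forms is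
`hasJordanType_iff`: row lengths of the conjugate partition are the successive differences of the
dimensions of ker N^i. -/

namespace QWhittaker

open Module

/-! ### Counting by fibres of constant size -/

section FibreCounting

theorem natCard_subtype_eq_mul {α β : Type*} [Finite α] [Finite β] (f : α → β)
    {R : α → Prop} {P : β → Prop} {c : ℝ} (hf : ∀ a, R a → P (f a))
    (hc : ∀ b, P b → (Nat.card {a // R a ∧ f a = b} : ℝ) = c) :
    (Nat.card {a // R a} : ℝ) = Nat.card {b // P b} * c := by
  classical
  have := Fintype.ofFinite {b // P b}
  let e : {a // R a} ≃ (Σ b : {b // P b}, {a // R a ∧ f a = b.1}) :=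
    { toFun := fun a => ⟨⟨f a.1, hf _ a.2⟩, ⟨a.1, a.2, rfl⟩⟩
      invFun := fun x => ⟨x.2.1, x.2.2.1⟩
      left_inv := fun _ => rfl
      right_inv := by
        rintro ⟨⟨b, hb⟩, ⟨a, ha, hab⟩⟩
        dsimp only at hab
        subst hab
        rfl }
  rw [Nat.card_congr e, Nat.card_sigma, Nat.cast_sum,
    Finset.sum_congr rfl (fun b _ => hc b.1 b.2)]
  simp

end FibreCounting

/-! ### Counting linear maps and subspaces over a finite field -/

section LinearCounting

variable {𝕜 : Type*} [Field 𝕜] [Finite 𝕜]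
variable {C V W : Type*} [AddCommGroup C] [Module 𝕜 C] [FiniteDimensional 𝕜 C]
  [AddCommGroup V] [Module 𝕜 V] [FiniteDimensional 𝕜 V]
  [AddCommGroup W] [Module 𝕜 W] [FiniteDimensional 𝕜 W]

theorem finite_linearMap : Finite (C →ₗ[𝕜] V) := Module.finite_of_finite 𝕜

theorem finite_submodule : Finite (Submodule 𝕜 V) := by
  have : Finite V := Module.finite_of_finite 𝕜
  exact Finite.of_injective (fun K : Submodule 𝕜 V => (K : Set V)) SetLike.coe_injective

omit [Finite 𝕜] in
theorem natCard_linearMap :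
    Nat.card (C →ₗ[𝕜] V) = Nat.card 𝕜 ^ (finrank 𝕜 C * finrank 𝕜 V) := by
  rw [Module.natCard_eq_pow_finrank (K := 𝕜), Module.finrank_linearMap]

theorem natCard_injective :
    (Nat.card {f : C →ₗ[𝕜] V // LinearMap.ker f = ⊥} : ℝ) =
      ∏ i ∈ Finset.range (finrank 𝕜 C),
        ((Nat.card 𝕜 : ℝ) ^ finrank 𝕜 V - (Nat.card 𝕜 : ℝ) ^ i) := by
  by_cases h : finrank 𝕜 C ≤ finrank 𝕜 V
  · have := Fintype.ofFinite 𝕜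
    have : Finite V := Module.finite_of_finite 𝕜
    let b := finBasis 𝕜 C
    have e : {f : C →ₗ[𝕜] V // LinearMap.ker f = ⊥} ≃
        {s : Fin (finrank 𝕜 C) → V // LinearIndependent 𝕜 s} := by
      refine ((b.constr 𝕜).symm.toEquiv).subtypeEquiv fun f => ?_
      constructor
      · intro hf
        exact b.linearIndependent.map' f hf
      · intro hf
        have hf' : LinearIndependent 𝕜 (f ∘ b) := hf
        rw [LinearMap.ker_eq_bot']
        intro m hm
        rw [← b.sum_repr m, map_sum] at hm
        simp only [map_smul] at hm
        have := (Fintype.linearIndependent_iff.mp hf') _ hm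
        rw [← b.sum_repr m]
        simp [this]
    rw [Nat.card_congr e, card_linearIndependent h, Finset.prod_range]
    push_cast
    refine Finset.prod_congr rfl fun i _ => ?_
    rw [Nat.cast_sub, Nat.card_eq_fintype_card]
    · push_cast
      rfl
    · exact Nat.pow_le_pow_right Fintype.card_pos (by omega)
  -- When C is too large there are no injections, and the product vanishes through its factor at i =
  -- dim V.
  · rw [Finset.prod_eq_zero (i := finrank 𝕜 V) (Finset.mem_range.mpr (by omega)) (sub_self _)]
    have : IsEmpty {f : C →ₗ[𝕜] V // LinearMap.ker f = ⊥} := by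
      refine ⟨fun f => h ?_⟩
      exact LinearMap.finrank_le_finrank_of_injective (LinearMap.ker_eq_bot.mp f.2)
    simp

/-- Split V = G ⊕ E: the component of f in G is free, and the component in E has to be injective.
The free part contributes a factor Q^(dim G) for each basis vector of C. -/
theorem natCard_comap_eq_bot (G : Submodule 𝕜 V) :
    (Nat.card {f : C →ₗ[𝕜] V // G.comap f = ⊥} : ℝ) =
      ∏ i ∈ Finset.range (finrank 𝕜 C),
        ((Nat.card 𝕜 : ℝ) ^ finrank 𝕜 V - (Nat.card 𝕜 : ℝ) ^ (finrank 𝕜 G + i)) := by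
  obtain ⟨E, hE⟩ := G.exists_isCompl
  let p := Submodule.prodEquivOfIsCompl G E hE
  let e₀ : ((C →ₗ[𝕜] G) × (C →ₗ[𝕜] E)) ≃ (C →ₗ[𝕜] V) :=
    (LinearMap.prodEquiv 𝕜).toEquiv.trans (LinearEquiv.congrRight p).toEquiv
  have he₀ : ∀ x c, e₀ x c = (x.1 c : V) + (x.2 c : V) := fun x c => rfl
  have e : {f : C →ₗ[𝕜] V // G.comap f = ⊥} ≃
      (C →ₗ[𝕜] G) × {g : C →ₗ[𝕜] E // LinearMap.ker g = ⊥} := by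
    refine (e₀.subtypeEquiv (p := fun x => LinearMap.ker x.2 = ⊥) fun x => ?_).symm.trans ?_
    · have : G.comap (e₀ x) = LinearMap.ker x.2 := by
        ext c
        rw [Submodule.mem_comap, he₀, Submodule.add_mem_iff_right _ (x.1 c).2, LinearMap.mem_ker]
        constructor
        · intro h
          have := (Submodule.disjoint_def.mp hE.disjoint) _ h (x.2 c).2
          exact Subtype.ext this
        · intro h
          simp [h]
      rw [this]
    · exact
        { toFun := fun x => (x.1.1, ⟨x.1.2, x.2⟩)
          invFun := fun y => ⟨(y.1, y.2.1), y.2.2⟩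
          left_inv := fun _ => rfl
          right_inv := fun _ => rfl }
  have hV : finrank 𝕜 V = finrank 𝕜 G + finrank 𝕜 E :=
    (Submodule.finrank_add_eq_of_isCompl hE).symm
  rw [Nat.card_congr e, Nat.card_prod, Nat.cast_mul, natCard_injective, natCard_linearMap, hV]
  push_cast
  simp only [pow_add, ← mul_sub]
  rw [Finset.prod_mul_distrib, Finset.prod_const, Finset.card_range, pow_mul']

theorem natCard_le_comap_eq_bot {G H : Submodule 𝕜 V} (hGH : G ≤ H) :
    (Nat.card {f : C →ₗ[𝕜] V // H.comap f = ⊤ ∧ G.comap f = ⊥} : ℝ) =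
      ∏ i ∈ Finset.range (finrank 𝕜 C),
        ((Nat.card 𝕜 : ℝ) ^ finrank 𝕜 H - (Nat.card 𝕜 : ℝ) ^ (finrank 𝕜 G + i)) := by
  have hG : finrank 𝕜 (G.submoduleOf H) = finrank 𝕜 G :=
    (Submodule.submoduleOfEquivOfLe hGH).finrank_eq
  rw [← hG, ← natCard_comap_eq_bot (C := C) (G.submoduleOf H)]
  congr 1
  refine Nat.card_congr
    { toFun := fun f => ⟨f.1.codRestrict H fun c => ?_, ?_⟩
      invFun := fun g => ⟨H.subtype ∘ₗ g.1, ?_, ?_⟩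
      left_inv := fun _ => rfl
      right_inv := fun _ => rfl }
  · have : c ∈ H.comap f.1 := by
      rw [f.2.1]
      exact Submodule.mem_top
    exact this
  · exact Eq.trans rfl f.2.2
  · ext c
    simp
  · exact Eq.trans rfl g.2

/-- Counting subspaces of a given dimension by their frames. -/
theorem natCard_submodule_mul (r : ℕ) :
    (Nat.card {K : Submodule 𝕜 C // finrank 𝕜 K = r} : ℝ) *
        ∏ i ∈ Finset.range r, ((Nat.card 𝕜 : ℝ) ^ r - (Nat.card 𝕜 : ℝ) ^ i) =
      ∏ i ∈ Finset.range r, ((Nat.card 𝕜 : ℝ) ^ finrank 𝕜 C - (Nat.card 𝕜 : ℝ) ^ i) := by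
  have := finite_linearMap (𝕜 := 𝕜) (C := Fin r → 𝕜) (V := C)
  have := finite_submodule (𝕜 := 𝕜) (V := C)
  have h := natCard_injective (𝕜 := 𝕜) (C := Fin r → 𝕜) (V := C)
  have h' := natCard_injective (𝕜 := 𝕜) (C := Fin r → 𝕜) (V := Fin r → 𝕜)
  rw [finrank_fin_fun] at h h'
  rw [← h, ← h']
  symm
  refine natCard_subtype_eq_mul (fun f => LinearMap.range f) (fun f hf => ?_) (fun K hK => ?_)
  · rw [LinearMap.finrank_range_of_inj (LinearMap.ker_eq_bot.mp hf), finrank_fin_fun]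
  · congr 1
    let e : K ≃ₗ[𝕜] (Fin r → 𝕜) := LinearEquiv.ofFinrankEq _ _ (by rw [hK, finrank_fin_fun])
    refine Nat.card_congr
      { toFun := fun f => ⟨e ∘ₗ f.1.codRestrict K fun c =>
          f.2.2.le (LinearMap.mem_range_self _ c), ?_⟩
        invFun := fun g => ⟨K.subtype ∘ₗ e.symm ∘ₗ g.1, ?_, ?_⟩
        left_inv := fun f => ?_
        right_inv := fun g => ?_ }
    · rw [LinearEquiv.ker_comp, LinearMap.ker_codRestrict]
      exact f.2.1
    · rw [LinearMap.ker_comp_of_ker_eq_bot _ K.ker_subtype, LinearEquiv.ker_comp]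
      exact g.2
    · have hg : LinearMap.range g.1 = ⊤ := LinearMap.ker_eq_bot_iff_range_eq_top.mp g.2
      rw [LinearMap.range_comp, LinearMap.range_comp, hg, Submodule.map_top,
        LinearEquiv.range, Submodule.map_top, Submodule.range_subtype]
    · ext x
      simp
    · refine Subtype.ext (LinearMap.ext fun x => ?_)
      exact e.apply_symm_apply _

end LinearCounting

/-! ### Factorials and binomials in q and in 1/q -/

section QAnalogues

theorem qFactorial_zero (q : ℝ) : qFactorial q 0 = 1 := by simp [qFactorial]

theorem qFactorial_succ (q : ℝ) (m : ℕ) :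
    qFactorial q (m + 1) = qFactorial q m * ∑ i ∈ Finset.range (m + 1), q ^ i :=
  Finset.prod_range_succ _ _

theorem qFactorial_pos {q : ℝ} (hq : 0 < q) (m : ℕ) : 0 < qFactorial q m :=
  Finset.prod_pos fun m _ => Finset.sum_pos (fun i _ => pow_pos hq i) ⟨0, by simp⟩

/-- Reversing a geometric sum multiplies it by a power of q. This is the passage from counts, which
are polynomial in the field size 1/q, to formulas in q. -/
theorem qFactorial_inv {q : ℝ} (hq : 0 < q) (m : ℕ) :
    qFactorial q⁻¹ m * q ^ m.choose 2 = qFactorial q m := by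
  induction m with
  | zero => simp [qFactorial_zero]
  | succ m ih =>
    have h : (∑ i ∈ Finset.range (m + 1), q⁻¹ ^ i) * q ^ m = ∑ i ∈ Finset.range (m + 1), q ^ i := by
      rw [← Finset.sum_range_reflect (fun i => q ^ i), Finset.sum_mul]
      refine Finset.sum_congr rfl fun i hi => ?_
      have hi' : i ≤ m := by have := Finset.mem_range.mp hi; omega
      rw [show m + 1 - 1 - i = m - i by omega, pow_sub₀ q hq.ne' hi', inv_pow, mul_comm]
    rw [qFactorial_succ, qFactorial_succ, ← h, ← ih, Nat.choose_succ_succ' m 1,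
      Nat.choose_one_right,
      pow_add]
    ring

/-- The product counting `r` vectors in a space of dimension `g + e` that are linearly independent
modulo a subspace of dimension `g`. -/
theorem prod_pow_sub_pow (Q : ℝ) (g e r : ℕ) (hr : r ≤ e) :
    (∏ i ∈ Finset.range r, (Q ^ (g + e) - Q ^ (g + i))) * qFactorial Q (e - r) =
      Q ^ (g * r + r.choose 2) * (Q - 1) ^ r * qFactorial Q e := by
  induction r with
  | zero => simp
  | succ r ih =>
    have ih := ih (by omega)
    have h : e - r = (e - (r + 1)) + 1 := by omega
    -- The new factor of the product contains the q-number [e - r]_Q, which is the top factor of [e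
    -- - r]_Q!.
    have hfac : Q ^ (g + e) - Q ^ (g + r) =
        Q ^ (g + r) * ((Q - 1) * ∑ i ∈ Finset.range (e - r), Q ^ i) := by
      rw [mul_geom_sum, mul_sub, ← pow_add, mul_one]
      congr 2
      omega
    rw [Finset.prod_range_succ, hfac, Nat.choose_succ_succ' r 1, Nat.choose_one_right]
    have h2 : qFactorial Q (e - r) =
        qFactorial Q (e - (r + 1)) * ∑ i ∈ Finset.range (e - r), Q ^ i := by
      conv_lhs => rw [h, qFactorial_succ, ← h]
    rw [h2] at ih
    calc _ = ((∏ i ∈ Finset.range r, (Q ^ (g + e) - Q ^ (g + i))) *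
          (qFactorial Q (e - (r + 1)) * ∑ i ∈ Finset.range (e - r), Q ^ i)) *
          (Q ^ (g + r) * (Q - 1)) := by ring
      _ = _ := by
        rw [ih]
        ring

theorem natCard_submodule {𝕜 : Type*} [Field 𝕜] [Finite 𝕜] {C : Type*} [AddCommGroup C]
    [Module 𝕜 C] [FiniteDimensional 𝕜 C] {r : ℕ} (hr : r ≤ finrank 𝕜 C) :
    (Nat.card {K : Submodule 𝕜 C // finrank 𝕜 K = r} : ℝ) =
      qBinomial (Nat.card 𝕜) (finrank 𝕜 C) r := by
  have h := natCard_submodule_mul (𝕜 := 𝕜) (C := C) r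
  have hQ1 : (1 : ℝ) < Nat.card 𝕜 := by exact_mod_cast Finite.one_lt_card
  have hQ : (0 : ℝ) < Nat.card 𝕜 := by linarith
  have h1 := prod_pow_sub_pow (Nat.card 𝕜 : ℝ) 0 r r le_rfl
  have h2 := prod_pow_sub_pow (Nat.card 𝕜 : ℝ) 0 (finrank 𝕜 C) r hr
  simp only [zero_add, zero_mul, Nat.sub_self, qFactorial_zero, mul_one] at h1 h2
  rw [h1] at h
  rw [← h] at h2
  have hr0 := qFactorial_pos hQ r
  have hr1 := qFactorial_pos hQ (finrank 𝕜 C - r)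
  have hc : (Nat.card 𝕜 : ℝ) ^ r.choose 2 * ((Nat.card 𝕜 : ℝ) - 1) ^ r ≠ 0 := by
    have : (0 : ℝ) < Nat.card 𝕜 - 1 := by linarith
    positivity
  rw [qBinomial, eq_div_iff (by positivity)]
  apply mul_left_cancel₀ hc
  linear_combination h2

end QAnalogues

/-! ### Linear maps with prescribed preimages of a flag -/

section FlaggedMaps

variable {𝕜 : Type*} [Field 𝕜]

theorem natCard_comap_eq_top {C V : Type*} [AddCommGroup C] [Module 𝕜 C] [FiniteDimensional 𝕜 C]
    [AddCommGroup V] [Module 𝕜 V] [FiniteDimensional 𝕜 V] (H : Submodule 𝕜 V) :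
    Nat.card {f : C →ₗ[𝕜] V // H.comap f = ⊤} =
      Nat.card 𝕜 ^ (finrank 𝕜 C * finrank 𝕜 H) := by
  rw [← natCard_linearMap]
  refine Nat.card_congr
    { toFun := fun f => f.1.codRestrict H fun c => ?_
      invFun := fun g => ⟨H.subtype ∘ₗ g, ?_⟩
      left_inv := fun _ => rfl
      right_inv := fun _ => rfl }
  · have : c ∈ H.comap f.1 := by
      rw [f.2]
      exact Submodule.mem_top
    exact this
  · ext c
    simp

/-- Splitting a linear map along a decomposition `C = K ⊕ D` when `K` is to be the preimage
of the subspace `G`. -/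
theorem comap_ofIsCompl_eq_iff {C V : Type*} [AddCommGroup C] [Module 𝕜 C]
    [AddCommGroup V] [Module 𝕜 V] {K D : Submodule 𝕜 C} (h : IsCompl K D) (G : Submodule 𝕜 V)
    (f : K →ₗ[𝕜] V) (g : D →ₗ[𝕜] V) :
    G.comap (LinearMap.ofIsCompl h f g) = K ↔ G.comap f = ⊤ ∧ G.comap g = ⊥ := by
  constructor
  · intro hK
    constructor
    · rw [eq_top_iff]
      intro x _
      have hx : (x : C) ∈ G.comap (LinearMap.ofIsCompl h f g) := by
        rw [hK]
        exact x.2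
      simpa using hx
    · rw [eq_bot_iff]
      intro x hx
      have hx' : (x : C) ∈ G.comap (LinearMap.ofIsCompl h f g) := by simpa using hx
      rw [hK] at hx'
      exact (Submodule.mem_bot 𝕜).mpr
        (Subtype.ext ((Submodule.disjoint_def.mp h.disjoint) _ hx' x.2))
  · rintro ⟨hf, hg⟩
    have hf' : ∀ x, f x ∈ G := fun x => by
      have : x ∈ G.comap f := hf ▸ Submodule.mem_top
      exact this
    ext c
    obtain ⟨x, y, rfl⟩ : ∃ (x : K) (y : D), (x : C) + y = c := by
      have := (Submodule.mem_sup.mp (h.sup_eq_top ▸ Submodule.mem_top : c ∈ K ⊔ D))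
      obtain ⟨x, hx, y, hy, rfl⟩ := this
      exact ⟨⟨x, hx⟩, ⟨y, hy⟩, rfl⟩
    rw [Submodule.mem_comap, map_add, LinearMap.ofIsCompl_apply_left,
      LinearMap.ofIsCompl_apply_right, Submodule.add_mem_iff_right _ (hf' x),
      Submodule.add_mem_iff_right _ x.2]
    have hy : g y ∈ G ↔ y = 0 := by
      rw [← Submodule.mem_comap, hg, Submodule.mem_bot]
    rw [hy]
    constructor
    · rintro rfl
      exact K.zero_mem
    · intro hyK
      exact Subtype.ext ((Submodule.disjoint_def.mp h.disjoint) _ hyK y.2)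

theorem comap_ofIsCompl_eq_top_iff {C V : Type*} [AddCommGroup C] [Module 𝕜 C]
    [AddCommGroup V] [Module 𝕜 V] {K D : Submodule 𝕜 C} (h : IsCompl K D) (G : Submodule 𝕜 V)
    (f : K →ₗ[𝕜] V) (g : D →ₗ[𝕜] V) :
    G.comap (LinearMap.ofIsCompl h f g) = ⊤ ↔ G.comap f = ⊤ ∧ G.comap g = ⊤ := by
  simp only [Submodule.eq_top_iff', Submodule.mem_comap]
  constructor
  · intro H
    exact ⟨fun x => by simpa using H x, fun x => by simpa using H x⟩
  · rintro ⟨hf, hg⟩ c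
    obtain ⟨x, hx, y, hy, rfl⟩ :=
      Submodule.mem_sup.mp (h.sup_eq_top ▸ Submodule.mem_top : c ∈ K ⊔ D)
    have h1 := LinearMap.ofIsCompl_apply_left h (φ := f) (ψ := g) ⟨x, hx⟩
    have h2 := LinearMap.ofIsCompl_apply_right h (φ := f) (ψ := g) ⟨y, hy⟩
    rw [map_add]
    exact G.add_mem (h1 ▸ hf _) (h2 ▸ hg _)

theorem finrank_comap_eq_of_le {C V : Type*} [AddCommGroup C] [Module 𝕜 C]
    [AddCommGroup V] [Module 𝕜 V] {K : Submodule 𝕜 C} {G : Submodule 𝕜 V}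
    (f : C →ₗ[𝕜] V) (h : G.comap f ≤ K) :
    finrank 𝕜 (G.comap (f ∘ₗ K.subtype)) = finrank 𝕜 (G.comap f) := by
  rw [← Submodule.finrank_map_subtype_eq, Submodule.comap_comp, Submodule.map_comap_subtype,
    inf_eq_right.mpr h]

/-- The number of linear maps into a flagged space for which the preimages of the steps of the flag
have prescribed dimensions. -/
theorem natCard_flagged_linearMap [Finite 𝕜] {V : Type*} [AddCommGroup V] [Module 𝕜 V]
    [FiniteDimensional 𝕜 V]
    {G : ℕ → Submodule 𝕜 V} (hG : Monotone G) {b : ℕ → ℕ} (hb : Monotone b) (L : ℕ) :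
    ∀ (C : Type*) [AddCommGroup C] [Module 𝕜 C] [FiniteDimensional 𝕜 C], finrank 𝕜 C = b L →
    (Nat.card {f : C →ₗ[𝕜] V // ∀ i ≤ L, finrank 𝕜 ((G i).comap f) = b i} : ℝ) =
      (Nat.card 𝕜 : ℝ) ^ (b 0 * finrank 𝕜 (G 0)) * ∏ i ∈ Finset.range L,
        (qBinomial (Nat.card 𝕜) (b (i + 1)) (b i) * ∏ s ∈ Finset.range (b (i + 1) - b i),
          ((Nat.card 𝕜 : ℝ) ^ finrank 𝕜 (G (i + 1)) -
            (Nat.card 𝕜 : ℝ) ^ (finrank 𝕜 (G i) + s))) := by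
  induction L with
  | zero =>
    intro C _ _ _ hC
    rw [Finset.prod_range_zero, mul_one, ← hC, ← Nat.cast_pow, ← natCard_comap_eq_top]
    congr 1
    refine Nat.card_congr (Equiv.subtypeEquivRight fun f => ?_)
    simp only [Nat.le_zero, forall_eq]
    constructor
    · intro h
      exact Submodule.eq_top_of_finrank_eq (h.trans hC.symm)
    · intro h
      rw [h, finrank_top, hC]
  | succ L ih =>
    intro C _ _ _ hC
    have := finite_linearMap (𝕜 := 𝕜) (C := C) (V := V)
    have := finite_submodule (𝕜 := 𝕜) (V := C)
    have hfib : ∀ K : Submodule 𝕜 C, finrank 𝕜 K = b L →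
        (Nat.card {f : C →ₗ[𝕜] V // (∀ i ≤ L + 1, finrank 𝕜 ((G i).comap f) = b i) ∧
          (G L).comap f = K} : ℝ) =
        (Nat.card 𝕜 : ℝ) ^ (b 0 * finrank 𝕜 (G 0)) * (∏ i ∈ Finset.range L,
        (qBinomial (Nat.card 𝕜) (b (i + 1)) (b i) * ∏ s ∈ Finset.range (b (i + 1) - b i),
          ((Nat.card 𝕜 : ℝ) ^ finrank 𝕜 (G (i + 1)) -
            (Nat.card 𝕜 : ℝ) ^ (finrank 𝕜 (G i) + s)))) * ∏ s ∈ Finset.range (b (L + 1) - b L),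
          ((Nat.card 𝕜 : ℝ) ^ finrank 𝕜 (G (L + 1)) -
            (Nat.card 𝕜 : ℝ) ^ (finrank 𝕜 (G L) + s)) := by
      intro K hK
      -- With K = f⁻¹(G_L) fixed, f splits into a map on K subject to the conditions up to L,
      -- counted by induction, and a map on a complement D into G_{L+1} that is injective modulo
      -- G_L.
      obtain ⟨D, hD⟩ := K.exists_isCompl
      have hDr : finrank 𝕜 D = b (L + 1) - b L := by
        have := Submodule.finrank_add_eq_of_isCompl hD
        omega
      rw [← ih K hK, ← hDr, ← natCard_le_comap_eq_bot (C := D) (hG (Nat.le_succ L)),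
        ← Nat.cast_mul, ← Nat.card_prod]
      congr 1
      symm
      refine Nat.card_congr (Equiv.trans (Equiv.subtypeProdEquivProd
        (p := fun f : K →ₗ[𝕜] V => ∀ i ≤ L, finrank 𝕜 ((G i).comap f) = b i)
        (q := fun g : D →ₗ[𝕜] V => (G (L + 1)).comap g = ⊤ ∧ (G L).comap g = ⊥)).symm
        ((LinearMap.ofIsComplProdEquiv hD).toEquiv.subtypeEquiv ?_))
      rintro ⟨f, g⟩
      change ((∀ i ≤ L, finrank 𝕜 ((G i).comap f) = b i) ∧ _) ↔
        (∀ i ≤ L + 1, finrank 𝕜 ((G i).comap (LinearMap.ofIsCompl hD f g)) = b i) ∧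
          (G L).comap (LinearMap.ofIsCompl hD f g) = K
      rw [comap_ofIsCompl_eq_iff]
      have hcomp : LinearMap.ofIsCompl hD f g ∘ₗ K.subtype = f := by
        ext x
        simp
      have key : (G L).comap f = ⊤ → (G L).comap g = ⊥ → ∀ i ≤ L,
          finrank 𝕜 ((G i).comap f) = finrank 𝕜 ((G i).comap (LinearMap.ofIsCompl hD f g)) := by
        intro h1 h2 i hi
        rw [← finrank_comap_eq_of_le (K := K) (LinearMap.ofIsCompl hD f g), hcomp]
        exact (Submodule.comap_mono (hG hi)).trans
          ((comap_ofIsCompl_eq_iff hD (G L) f g).mpr ⟨h1, h2⟩).le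
      have htop : (G (L + 1)).comap f = ⊤ → ((G (L + 1)).comap g = ⊤ ↔
          finrank 𝕜 ((G (L + 1)).comap (LinearMap.ofIsCompl hD f g)) = b (L + 1)) := by
        intro hf
        rw [← hC]
        refine ⟨fun hg => ?_, fun h => ?_⟩
        · rw [(comap_ofIsCompl_eq_top_iff hD _ f g).mpr ⟨hf, hg⟩, finrank_top]
        · exact ((comap_ofIsCompl_eq_top_iff hD _ f g).mp
            (Submodule.eq_top_of_finrank_eq h)).2
      have hle : (G L).comap f = ⊤ → (G (L + 1)).comap f = ⊤ := fun h =>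
        eq_top_iff.mpr (h ▸ Submodule.comap_mono (hG (Nat.le_succ L)))
      constructor
      · rintro ⟨h1, h2, h3⟩
        have h4 : (G L).comap f = ⊤ := Submodule.eq_top_of_finrank_eq ((h1 L le_rfl).trans hK.symm)
        refine ⟨fun i hi => ?_, h4, h3⟩
        rcases Nat.le_succ_iff.mp hi with hi | rfl
        · rw [← key h4 h3 i hi, h1 i hi]
        · exact (htop (hle h4)).mp h2
      · rintro ⟨h1, h2, h3⟩
        refine ⟨fun i hi => ?_, (htop (hle h2)).mpr (h1 _ le_rfl), h3⟩
        rw [key h2 h3 i hi, h1 i (by omega)]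
    have hcard := natCard_subtype_eq_mul (fun f : C →ₗ[𝕜] V => (G L).comap f)
      (R := fun f => ∀ i ≤ L + 1, finrank 𝕜 ((G i).comap f) = b i)
      (P := fun K => finrank 𝕜 K = b L) (fun f hf => hf L (Nat.le_succ L))
      hfib
    rw [hcard, natCard_submodule (hC ▸ hb (Nat.le_succ L)), hC,
      Finset.prod_range_succ]
    ring

end FlaggedMaps

/-! ### Row lengths and horizontal strips -/

section YoungDiagrams

theorem sum_rowLen_eq_card (μ : YoungDiagram) {L : ℕ} (hL : μ.rowLen L = 0) :
    ∑ s ∈ Finset.range L, μ.rowLen s = μ.card := by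
  rw [YoungDiagram.card, Finset.card_eq_sum_card_fiberwise (f := Prod.fst)
    (t := Finset.range L)]
  · exact Finset.sum_congr rfl fun s _ => μ.rowLen_eq_card
  · rintro ⟨s, c⟩ hc
    have h1 : c < μ.rowLen s := YoungDiagram.mem_iff_lt_rowLen.mp hc
    simp only [Finset.coe_range, Set.mem_Iio]
    by_contra hs
    have := μ.rowLen_anti L s (by omega)
    omega

theorem rowLen_eq_zero_of_le (μ : YoungDiagram) {L s : ℕ} (hL : μ.rowLen L = 0) (h : L ≤ s) :
    μ.rowLen s = 0 := by
  have := μ.rowLen_anti L s h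
  omega

theorem rowLen_bot (s : ℕ) : (⊥ : YoungDiagram).rowLen s = 0 := by
  by_contra h
  exact YoungDiagram.notMem_bot _ (YoungDiagram.mem_iff_lt_rowLen.mpr (Nat.pos_of_ne_zero h))

theorem rowLen_colLen_zero (μ : YoungDiagram) : μ.rowLen (μ.colLen 0) = 0 := by
  by_contra h
  have := YoungDiagram.mem_iff_lt_rowLen.mpr (Nat.pos_of_ne_zero h)
  exact lt_irrefl _ (YoungDiagram.mem_iff_lt_colLen.mp this)

/-- The skew diagram `lam / μ` is a horizontal strip. -/
def IsHorizontalStrip (μ lam : YoungDiagram) : Prop :=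
  ∀ s, μ.rowLen s ≤ lam.rowLen s ∧ lam.rowLen (s + 1) ≤ μ.rowLen s

end YoungDiagrams

/-! ### Kernels of powers and the flag that governs extensions -/

section KernelType

variable {𝕜 : Type*} [Field 𝕜] {V : Type*} [AddCommGroup V] [Module 𝕜 V]

/-- The kernels of the powers of `N` on the subspace `U` have the dimensions prescribed by `μ`. -/
def HasKernelType (N : Module.End 𝕜 V) (U : Submodule 𝕜 V) (μ : YoungDiagram) : Prop :=
  ∀ i, finrank 𝕜 (U ⊓ LinearMap.ker (N ^ i) : Submodule 𝕜 V) = ∑ s ∈ Finset.range i, μ.rowLen s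

theorem hasKernelType_bot (N : Module.End 𝕜 V) : HasKernelType N ⊥ ⊥ := by
  intro i
  simp [rowLen_bot]

theorem pow_apply_eq_of_eqOn {N N' : Module.End 𝕜 V} {W : Submodule 𝕜 V} (hW : W.map N ≤ W)
    (h : ∀ w ∈ W, N' w = N w) (i : ℕ) : ∀ w ∈ W, (N' ^ i) w = (N ^ i) w := by
  induction i with
  | zero => simp
  | succ i ih =>
    intro w hw
    rw [pow_succ, pow_succ, Module.End.mul_apply, Module.End.mul_apply, h w hw,
      ih _ (hW (Submodule.mem_map_of_mem hw))]

theorem inf_ker_pow_congr {N N' : Module.End 𝕜 V} {W : Submodule 𝕜 V} (hW : W.map N ≤ W)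
    (h : ∀ w ∈ W, N' w = N w) (i : ℕ) :
    W ⊓ LinearMap.ker (N' ^ i) = W ⊓ LinearMap.ker (N ^ i) := by
  ext w
  simp only [Submodule.mem_inf, LinearMap.mem_ker]
  exact and_congr_right fun hw => by rw [pow_apply_eq_of_eqOn hW h i w hw]

theorem map_congr_of_eqOn {N N' : Module.End 𝕜 V} {W : Submodule 𝕜 V}
    (h : ∀ w ∈ W, N' w = N w) : W.map N' = W.map N := by
  ext v
  simp only [Submodule.mem_map]
  exact exists_congr fun w => and_congr_right fun hw => by rw [h w hw]

variable [FiniteDimensional 𝕜 V]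

theorem finrank_map_add_finrank_inf_ker {V' : Type*} [AddCommGroup V'] [Module 𝕜 V']
    (f : V →ₗ[𝕜] V') (S : Submodule 𝕜 V) :
    finrank 𝕜 (S.map f) + finrank 𝕜 (S ⊓ LinearMap.ker f : Submodule 𝕜 V) = finrank 𝕜 S := by
  have h := (f ∘ₗ S.subtype).finrank_range_add_finrank_ker
  rw [LinearMap.range_comp, Submodule.range_subtype, LinearMap.ker_comp] at h
  rw [← h, ← Submodule.finrank_map_subtype_eq, Submodule.map_comap_subtype]

/-- The step `N W + (W ⊓ ker N ^ i)` of the flag in `W` that controls extensions of `N`. -/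
def extensionFlag (N : Module.End 𝕜 V) (W : Submodule 𝕜 V) (i : ℕ) : Submodule 𝕜 V :=
  W.map N ⊔ (W ⊓ LinearMap.ker (N ^ i))

omit [FiniteDimensional 𝕜 V] in
theorem ker_pow_mono (N : Module.End 𝕜 V) : Monotone fun i => LinearMap.ker (N ^ i) := by
  refine monotone_nat_of_le_succ fun i v hv => ?_
  rw [LinearMap.mem_ker] at hv ⊢
  rw [pow_succ', Module.End.mul_apply, hv, map_zero]

omit [FiniteDimensional 𝕜 V] in
theorem extensionFlag_mono (N : Module.End 𝕜 V) (W : Submodule 𝕜 V) :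
    Monotone (extensionFlag N W) :=
  fun _ _ h => sup_le_sup_left (inf_le_inf_left _ (ker_pow_mono N h)) _

omit [FiniteDimensional 𝕜 V] in
theorem map_inf_ker_pow_succ (N : Module.End 𝕜 V) (W : Submodule 𝕜 V) (i : ℕ) :
    (W ⊓ LinearMap.ker (N ^ (i + 1))).map N = W.map N ⊓ LinearMap.ker (N ^ i) := by
  ext v
  simp only [Submodule.mem_map, Submodule.mem_inf, LinearMap.mem_ker, pow_succ,
    Module.End.mul_apply]
  constructor
  · rintro ⟨w, ⟨hw, h⟩, rfl⟩
    exact ⟨⟨w, hw, rfl⟩, h⟩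
  · rintro ⟨⟨w, hw, rfl⟩, h⟩
    exact ⟨w, ⟨hw, h⟩, rfl⟩

/-- Put K_i = W ∩ ker N^i. Then N W ∩ K_i = N K_{i+1} has dimension dim K_{i+1} - dim K_1, and dim N
W = dim W - dim K_1. In dim (N W + K_i) the terms dim K_1 cancel and dim W - (dim K_{i+1} - dim K_i)
remains. -/
theorem finrank_extensionFlag_add {N : Module.End 𝕜 V} {W : Submodule 𝕜 V} {μ : YoungDiagram}
    (hW : W.map N ≤ W) (hμ : HasKernelType N W μ) (i : ℕ) :
    finrank 𝕜 (extensionFlag N W i) + μ.rowLen i = finrank 𝕜 W := by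
  have h1 := Submodule.finrank_sup_add_finrank_inf_eq (W.map N) (W ⊓ LinearMap.ker (N ^ i))
  have h2 := finrank_map_add_finrank_inf_ker N W
  have h3 := finrank_map_add_finrank_inf_ker N (W ⊓ LinearMap.ker (N ^ (i + 1)))
  have h4 : W.map N ⊓ (W ⊓ LinearMap.ker (N ^ i)) =
      (W ⊓ LinearMap.ker (N ^ (i + 1))).map N := by
    rw [map_inf_ker_pow_succ, ← inf_assoc, inf_eq_left.mpr hW]
  have h5 : W ⊓ LinearMap.ker (N ^ (i + 1)) ⊓ LinearMap.ker N = W ⊓ LinearMap.ker N := by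
    have : LinearMap.ker N ≤ LinearMap.ker (N ^ (i + 1)) := by
      simpa using ker_pow_mono N (show 1 ≤ i + 1 by omega)
    rw [inf_assoc, inf_eq_right.mpr this]
  have h6 := hμ (i + 1)
  have h7 := hμ i
  rw [Finset.sum_range_succ] at h6
  rw [h4] at h1
  rw [h5] at h3
  unfold extensionFlag
  omega

/-- Project U ∩ ker N^(i+1) to C along D. The kernel is W ∩ ker N^(i+1), because U ∩ D = W. A vector
c is in the image iff some c - w with w in W is killed by N^(i+1), that is, iff N c lies in N W + (W
∩ ker N^i). -/
theorem finrank_inf_ker_pow_succ {N : Module.End 𝕜 V} {W U C D : Submodule 𝕜 V}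
    (hCD : IsCompl C D) (hWD : W ≤ D) (hU : W ⊔ C = U) (hN : U.map N ≤ W) (i : ℕ) :
    finrank 𝕜 (U ⊓ LinearMap.ker (N ^ (i + 1)) : Submodule 𝕜 V) =
      finrank 𝕜 (W ⊓ LinearMap.ker (N ^ (i + 1)) : Submodule 𝕜 V) +
        finrank 𝕜 ((extensionFlag N W i).comap (N ∘ₗ C.subtype)) := by
  have hN' : ∀ u ∈ U, N u ∈ W := fun u hu => hN (Submodule.mem_map_of_mem hu)
  have hWU : W ≤ U := hU ▸ le_sup_left
  have hCU : C ≤ U := hU ▸ le_sup_right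
  have hUD : U ⊓ D = W := by
    refine le_antisymm ?_ (le_inf hWU hWD)
    rintro v ⟨hv, hvD⟩
    rw [SetLike.mem_coe, ← hU] at hv
    obtain ⟨w, hw, c, hc, rfl⟩ := Submodule.mem_sup.mp hv
    have hcD : c ∈ D := (Submodule.add_mem_iff_right D (hWD hw)).mp hvD
    rw [Submodule.disjoint_def.mp hCD.disjoint c hc hcD, add_zero]
    exact hw
  have himage : (U ⊓ LinearMap.ker (N ^ (i + 1))).map (C.projectionOnto D hCD) =
      (extensionFlag N W i).comap (N ∘ₗ C.subtype) := by
    ext c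
    simp only [Submodule.mem_map, Submodule.mem_comap, Submodule.mem_inf, LinearMap.mem_ker,
      extensionFlag, LinearMap.comp_apply, Submodule.subtype_apply, Submodule.mem_sup]
    constructor
    · rintro ⟨v, ⟨hv, hker⟩, rfl⟩
      rw [← hU] at hv
      obtain ⟨w, hw, c, hc, rfl⟩ := Submodule.mem_sup.mp hv
      have hp : C.projectionOnto D hCD (w + c) = ⟨c, hc⟩ := by
        rw [map_add, (Submodule.projectionOnto_apply_eq_zero_iff hCD).mpr (hWD hw), zero_add]
        exact Submodule.projectionOnto_apply_left hCD ⟨c, hc⟩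
      rw [hp]
      refine ⟨N (-w), ⟨-w, W.neg_mem hw, rfl⟩, N (w + c), ⟨hN' _ (hU ▸ hv), ?_⟩, ?_⟩
      · rw [← Module.End.mul_apply, ← pow_succ, hker]
      · simp
    · rintro ⟨_, ⟨w, hw, rfl⟩, z, ⟨hz, hker⟩, h⟩
      refine ⟨c - w, ⟨U.sub_mem (hCU c.2) (hWU hw), ?_⟩, ?_⟩
      · rw [pow_succ, Module.End.mul_apply, map_sub, ← h, add_sub_cancel_left, hker]
      · rw [map_sub, (Submodule.projectionOnto_apply_eq_zero_iff hCD).mpr (hWD hw), sub_zero]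
        exact Submodule.projectionOnto_apply_left hCD c
  rw [← finrank_map_add_finrank_inf_ker (C.projectionOnto D hCD) (U ⊓ LinearMap.ker (N ^ (i + 1))),
    himage, Submodule.ker_projectionOnto, inf_right_comm, hUD, add_comm]

end KernelType

/-! ### Counting endomorphisms one flag step at a time -/

section Extensions

variable {𝕜 : Type*} [Field 𝕜] {V : Type*} [AddCommGroup V] [Module 𝕜 V] [FiniteDimensional 𝕜 V]

omit [FiniteDimensional 𝕜 V] in
theorem hasKernelType_congr {N N' : Module.End 𝕜 V} {W : Submodule 𝕜 V} (hW : W.map N ≤ W)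
    (h : ∀ w ∈ W, N' w = N w) (μ : YoungDiagram) : HasKernelType N' W μ ↔ HasKernelType N W μ := by
  refine forall_congr' fun i => ?_
  rw [inf_ker_pow_congr hW h]

omit [FiniteDimensional 𝕜 V] in
theorem extensionFlag_congr {N N' : Module.End 𝕜 V} {W : Submodule 𝕜 V} (hW : W.map N ≤ W)
    (h : ∀ w ∈ W, N' w = N w) (i : ℕ) : extensionFlag N' W i = extensionFlag N W i := by
  rw [extensionFlag, extensionFlag, inf_ker_pow_congr hW h, map_congr_of_eqOn h]

omit [FiniteDimensional 𝕜 V] in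
theorem extensionFlag_le {N : Module.End 𝕜 V} {W : Submodule 𝕜 V} (hW : W.map N ≤ W) (i : ℕ) :
    extensionFlag N W i ≤ W :=
  sup_le hW inf_le_left

/-- The type of an extension of `N` from `W` to `W ⊔ C` is determined by the preimages of the
flag `extensionFlag N W` in `C`. -/
theorem hasKernelType_extension_iff {N : Module.End 𝕜 V} {W U C D : Submodule 𝕜 V}
    {μ lam : YoungDiagram} (hCD : IsCompl C D) (hWD : W ≤ D) (hU : W ⊔ C = U)
    (hW : W.map N ≤ W) (hμ : HasKernelType N W μ) (hWc : finrank 𝕜 W = μ.card)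
    (hUc : finrank 𝕜 U = lam.card) (hstrip : IsHorizontalStrip μ lam) {L : ℕ}
    (hL : lam.rowLen L = 0) :
    (U.map N ≤ W ∧ HasKernelType N U lam) ↔
      ∀ i ≤ L, finrank 𝕜 ((extensionFlag N W i).comap (N ∘ₗ C.subtype)) =
        ∑ s ∈ Finset.range (i + 1), (lam.rowLen s - μ.rowLen s) := by
  have hsum : ∀ i, ∑ s ∈ Finset.range i, lam.rowLen s =
      ∑ s ∈ Finset.range i, μ.rowLen s +
        ∑ s ∈ Finset.range i, (lam.rowLen s - μ.rowLen s) := by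
    intro i
    rw [← Finset.sum_add_distrib]
    exact Finset.sum_congr rfl fun s _ => by have := (hstrip s).1; omega
  have hμL : μ.rowLen L = 0 := by have := (hstrip L).1; omega
  constructor
  · rintro ⟨hN, hlam⟩ i _
    have h1 := finrank_inf_ker_pow_succ hCD hWD hU hN i
    rw [hlam, hμ, hsum] at h1
    omega
  · intro h
    -- Row L of μ is empty, so the condition at i = L says that N maps all of C into W;
    -- compatibility need not be imposed separately.
    have hflag : extensionFlag N W L = W := by
      refine Submodule.eq_of_le_of_finrank_eq (extensionFlag_le hW L) ?_
      have := finrank_extensionFlag_add hW hμ L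
      omega
    have hdisj : W ⊓ C = ⊥ := by
      rw [inf_comm]
      exact (hCD.disjoint.mono_right hWD).eq_bot
    have hC : finrank 𝕜 C + μ.card = lam.card := by
      have := Submodule.finrank_sup_add_finrank_inf_eq W C
      rw [hU, hdisj, finrank_bot] at this
      omega
    have htop : (extensionFlag N W L).comap (N ∘ₗ C.subtype) = ⊤ := by
      refine Submodule.eq_top_of_finrank_eq ?_
      rw [h L le_rfl]
      have h1 := hsum (L + 1)
      rw [Finset.sum_range_succ, sum_rowLen_eq_card lam hL, Finset.sum_range_succ,
        sum_rowLen_eq_card μ hμL] at h1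
      omega
    have hN : U.map N ≤ W := by
      rw [← hU, Submodule.map_sup]
      refine sup_le hW ?_
      rintro _ ⟨c, hc, rfl⟩
      have : (⟨c, hc⟩ : C) ∈ (extensionFlag N W L).comap (N ∘ₗ C.subtype) :=
        htop ▸ Submodule.mem_top
      rw [hflag] at this
      exact this
    refine ⟨hN, ?_⟩
    have hsucc : ∀ i ≤ L, finrank 𝕜 (U ⊓ LinearMap.ker (N ^ (i + 1)) : Submodule 𝕜 V) =
        ∑ s ∈ Finset.range (i + 1), lam.rowLen s := by
      intro i hi
      rw [finrank_inf_ker_pow_succ hCD hWD hU hN i, hμ, h i hi, hsum]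
    intro i
    rcases Nat.lt_or_ge (L + 1) i with hi | hi
    -- At the power L + 1 the kernel already has the dimension of U, so higher powers add nothing.
    · have hcard : ∀ j, L ≤ j → ∑ s ∈ Finset.range j, lam.rowLen s = finrank 𝕜 U := fun j hj => by
        rw [sum_rowLen_eq_card lam (rowLen_eq_zero_of_le lam hL hj), hUc]
      have h1 := hsucc L le_rfl
      rw [hcard _ (by omega)] at h1
      rw [hcard _ (by omega)]
      refine le_antisymm (Submodule.finrank_mono inf_le_left) (h1.ge.trans ?_)
      exact Submodule.finrank_mono (inf_le_inf_left _ (ker_pow_mono N (by omega)))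
    · rcases i with _ | i
      · simp [Module.End.one_eq_id]
      · exact hsucc i (by omega)

/-- The increments of the row lengths from `μ` to `lam`, summed over the first `i + 1` rows. -/
def stripSum (μ lam : YoungDiagram) (i : ℕ) : ℕ :=
  ∑ s ∈ Finset.range (i + 1), (lam.rowLen s - μ.rowLen s)

theorem stripSum_mono (μ lam : YoungDiagram) : Monotone (stripSum μ lam) :=
  monotone_nat_of_le_succ fun i => by
    rw [stripSum, stripSum, Finset.sum_range_succ _ (i + 1)]
    exact Nat.le_add_right _ _

/-- The number of extensions of an endomorphism of type `μ` to one of type `lam`. -/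
noncomputable def extensionCount (Q : ℝ) (μ lam : YoungDiagram) : ℝ :=
  Q ^ (stripSum μ lam 0 * (μ.card - μ.rowLen 0)) * ∏ i ∈ Finset.range (lam.colLen 0),
    (qBinomial Q (stripSum μ lam (i + 1)) (stripSum μ lam i) *
      ∏ s ∈ Finset.range (stripSum μ lam (i + 1) - stripSum μ lam i),
        (Q ^ (μ.card - μ.rowLen (i + 1)) - Q ^ (μ.card - μ.rowLen i + s)))

/-- The endomorphism `N` is strictly compatible with the first `j` steps of the flag `F`, and its
restrictions to these steps have the types `ν`. -/
def IsAdapted (F : ℕ → Submodule 𝕜 V) (ν : ℕ → YoungDiagram) (j : ℕ) (N : Module.End 𝕜 V) : Prop :=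
  ∀ i < j, (F (i + 1)).map N ≤ F i ∧ HasKernelType N (F (i + 1)) (ν (i + 1))

omit [FiniteDimensional 𝕜 V] in
theorem isAdapted_succ_iff {F : ℕ → Submodule 𝕜 V} {ν : ℕ → YoungDiagram} {j : ℕ}
    {N : Module.End 𝕜 V} : IsAdapted F ν (j + 1) N ↔
      IsAdapted F ν j N ∧ (F (j + 1)).map N ≤ F j ∧ HasKernelType N (F (j + 1)) (ν (j + 1)) :=
  Nat.forall_lt_succ_right

omit [FiniteDimensional 𝕜 V] in
theorem IsAdapted.map_le {F : ℕ → Submodule 𝕜 V} {ν : ℕ → YoungDiagram} {j : ℕ}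
    {N : Module.End 𝕜 V} (hF : Monotone F) (hF0 : F 0 = ⊥) (h : IsAdapted F ν j N) :
    (F j).map N ≤ F j := by
  rcases j with _ | j
  · simp [hF0]
  · exact (h j (Nat.lt_succ_self j)).1.trans (hF (Nat.le_succ j))

omit [FiniteDimensional 𝕜 V] in
theorem IsAdapted.hasKernelType {F : ℕ → Submodule 𝕜 V} {ν : ℕ → YoungDiagram} {j : ℕ}
    {N : Module.End 𝕜 V} (hF0 : F 0 = ⊥) (hν0 : ν 0 = ⊥) (h : IsAdapted F ν j N) :
    HasKernelType N (F j) (ν j) := by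
  rcases j with _ | j
  · rw [hF0, hν0]
    exact hasKernelType_bot N
  · exact (h j (Nat.lt_succ_self j)).2

omit [FiniteDimensional 𝕜 V] in
theorem isAdapted_congr {F : ℕ → Submodule 𝕜 V} {ν : ℕ → YoungDiagram} {j : ℕ}
    {N N' : Module.End 𝕜 V} (hF : Monotone F) (h : ∀ w ∈ F j, N' w = N w) :
    IsAdapted F ν j N' ↔ IsAdapted F ν j N := by
  refine forall₂_congr fun i hi => ?_
  have hi' : ∀ w ∈ F (i + 1), N' w = N w := fun w hw => h w (hF hi hw)
  rw [map_congr_of_eqOn hi']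
  refine and_congr_right fun hN => ?_
  exact hasKernelType_congr (hN.trans (hF (Nat.le_succ i))) hi' _

/-- Let C complement F_j in F_{j+1}, and let D ⊇ F_j complement C in V. The first j conditions see
only N|_D and leave N|_C free, with Q^(dim C · dim V) choices; the next condition leaves
`extensionCount` choices for N|_C. Counting endomorphisms of the whole of V keeps the domain fixed
throughout the induction. -/
theorem natCard_isAdapted_succ [Finite 𝕜] {F : ℕ → Submodule 𝕜 V} {ν : ℕ → YoungDiagram} {j : ℕ}
    (hF : Monotone F) (hF0 : F 0 = ⊥) (hν0 : ν 0 = ⊥)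
    (hcard : ∀ i, i ≤ j + 1 → finrank 𝕜 (F i) = (ν i).card)
    (hstrip : IsHorizontalStrip (ν j) (ν (j + 1))) :
    (Nat.card {N : Module.End 𝕜 V // IsAdapted F ν (j + 1) N} : ℝ) *
        (Nat.card 𝕜 : ℝ) ^ (((ν (j + 1)).card - (ν j).card) * finrank 𝕜 V) =
      Nat.card {N : Module.End 𝕜 V // IsAdapted F ν j N} *
        extensionCount (Nat.card 𝕜) (ν j) (ν (j + 1)) := by
  obtain ⟨C, hC1, hC2⟩ : ∃ C : Submodule 𝕜 V, F j ⊔ C = F (j + 1) ∧ Disjoint (F j) C := by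
    obtain ⟨E, hE⟩ := (F j).exists_isCompl
    refine ⟨E ⊓ F (j + 1), ?_, hE.disjoint.mono_right inf_le_left⟩
    rw [← sup_inf_assoc_of_le _ (hF (Nat.le_succ j)), hE.sup_eq_top, top_inf_eq]
  obtain ⟨D, hD1, hD2⟩ : ∃ D : Submodule 𝕜 V, F j ≤ D ∧ IsCompl C D := by
    obtain ⟨D, hD, hCD⟩ := hC2.exists_isCompl
    exact ⟨D, hD, hCD.symm⟩
  have hCr : finrank 𝕜 C = (ν (j + 1)).card - (ν j).card := by
    have := Submodule.finrank_sup_add_finrank_inf_eq (F j) C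
    rw [hC1, hC2.eq_bot, finrank_bot, hcard j (Nat.le_succ j), hcard (j + 1) le_rfl] at this
    omega
  have hfin := finite_linearMap (𝕜 := 𝕜) (C := V) (V := V)
  have hfin' := finite_linearMap (𝕜 := 𝕜) (C := D) (V := V)
  have hext : ∀ (f : C →ₗ[𝕜] V) (g : D →ₗ[𝕜] V), ∀ w ∈ F j,
      LinearMap.ofIsCompl hD2 f g w = LinearMap.ofIsCompl hD2 0 g w := by
    intro f g w hw
    have h1 := LinearMap.ofIsCompl_apply_right hD2 (φ := f) (ψ := g) ⟨w, hD1 hw⟩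
    have h2 := LinearMap.ofIsCompl_apply_right hD2 (φ := 0) (ψ := g) ⟨w, hD1 hw⟩
    exact h1.trans h2.symm
  -- Extension by zero on C serves as the representative of all N with a given restriction to D.
  have hbase : Nat.card {N : Module.End 𝕜 V // IsAdapted F ν j N} =
      Nat.card 𝕜 ^ (finrank 𝕜 C * finrank 𝕜 V) *
      Nat.card {g : D →ₗ[𝕜] V // IsAdapted F ν j (LinearMap.ofIsCompl hD2 0 g)} := by
    rw [← natCard_linearMap, ← Nat.card_prod]
    symm
    refine Nat.card_congr (Equiv.trans ?_ ((LinearMap.ofIsComplProdEquiv hD2).toEquiv.subtypeEquiv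
      (p := fun x => IsAdapted F ν j (LinearMap.ofIsCompl hD2 0 x.2)) ?_))
    · exact
        { toFun := fun x => ⟨(x.1, x.2.1), x.2.2⟩
          invFun := fun x => (x.1.1, ⟨x.1.2, x.2⟩)
          left_inv := fun _ => rfl
          right_inv := fun _ => rfl }
    · rintro ⟨f, g⟩
      exact (isAdapted_congr hF (hext f g)).symm
  have hfib : ∀ g : D →ₗ[𝕜] V, IsAdapted F ν j (LinearMap.ofIsCompl hD2 0 g) →
      (Nat.card {N : Module.End 𝕜 V // IsAdapted F ν (j + 1) N ∧ N ∘ₗ D.subtype = g} : ℝ) =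
        extensionCount (Nat.card 𝕜) (ν j) (ν (j + 1)) := by
    intro g hg
    set N₀ := LinearMap.ofIsCompl hD2 0 g with hN₀
    have hW := hg.map_le hF hF0
    have hμ := hg.hasKernelType hF0 hν0
    have hL := rowLen_colLen_zero (ν (j + 1))
    have hCL : finrank 𝕜 C = stripSum (ν j) (ν (j + 1)) ((ν (j + 1)).colLen 0) := by
      have hL' : (ν j).rowLen ((ν (j + 1)).colLen 0) = 0 := by
        have := (hstrip ((ν (j + 1)).colLen 0)).1
        omega
      have h1 := sum_rowLen_eq_card (ν (j + 1)) hL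
      have h2 := sum_rowLen_eq_card (ν j) hL'
      have h3 : ∑ s ∈ Finset.range ((ν (j + 1)).colLen 0), (ν (j + 1)).rowLen s =
          ∑ s ∈ Finset.range ((ν (j + 1)).colLen 0), (ν j).rowLen s +
          ∑ s ∈ Finset.range ((ν (j + 1)).colLen 0),
            ((ν (j + 1)).rowLen s - (ν j).rowLen s) := by
        rw [← Finset.sum_add_distrib]
        exact Finset.sum_congr rfl fun s _ => by have := (hstrip s).1; omega
      rw [stripSum, Finset.sum_range_succ, hL, hCr]
      omega
    have hflag : ∀ i, finrank 𝕜 (extensionFlag N₀ (F j) i) = (ν j).card - (ν j).rowLen i := by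
      intro i
      have := finrank_extensionFlag_add hW hμ i
      rw [hcard j (Nat.le_succ j)] at this
      omega
    have hcount := natCard_flagged_linearMap (extensionFlag_mono N₀ (F j))
      (stripSum_mono (ν j) (ν (j + 1))) _ C hCL
    simp only [hflag] at hcount
    rw [extensionCount, ← hcount]
    congr 1
    have key : ∀ N : Module.End 𝕜 V, N ∘ₗ D.subtype = g → (IsAdapted F ν (j + 1) N ↔
        ∀ i ≤ (ν (j + 1)).colLen 0,
          finrank 𝕜 ((extensionFlag N₀ (F j) i).comap (N ∘ₗ C.subtype)) =
            stripSum (ν j) (ν (j + 1)) i) := by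
      intro N hN
      have hNe : ∀ w ∈ F j, N w = N₀ w := by
        intro w hw
        have h1 := LinearMap.ofIsCompl_apply_right hD2 (φ := 0) (ψ := g) ⟨w, hD1 hw⟩
        exact (LinearMap.congr_fun hN ⟨w, hD1 hw⟩).trans h1.symm
      have hN' : IsAdapted F ν j N := (isAdapted_congr hF hNe).mpr hg
      rw [isAdapted_succ_iff, and_iff_right hN',
        hasKernelType_extension_iff hD2 hD1 hC1 (hN'.map_le hF hF0) (hN'.hasKernelType hF0 hν0)
          (hcard j (Nat.le_succ j)) (hcard (j + 1) le_rfl) hstrip hL]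
      refine forall₂_congr fun i _ => ?_
      rw [extensionFlag_congr hW hNe, stripSum]
    refine Nat.card_congr
      { toFun := fun N => ⟨N.1 ∘ₗ C.subtype, (key N.1 N.2.2).mp N.2.1⟩
        invFun := fun f => ⟨LinearMap.ofIsCompl hD2 f.1 g, ?_⟩
        left_inv := ?_
        right_inv := ?_ }
    · have h1 : LinearMap.ofIsCompl hD2 f.1 g ∘ₗ D.subtype = g := by
        ext x
        simp
      have h2 : LinearMap.ofIsCompl hD2 f.1 g ∘ₗ C.subtype = f.1 := by
        ext x
        simp
      refine ⟨(key _ h1).mpr ?_, h1⟩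
      rw [h2]
      exact f.2
    · rintro ⟨N, hN, rfl⟩
      exact Subtype.ext (LinearMap.ofIsCompl_eq hD2 (fun _ => rfl) (fun _ => rfl))
    · rintro ⟨f, hf⟩
      refine Subtype.ext ?_
      ext x
      simp
  rw [natCard_subtype_eq_mul (fun N : Module.End 𝕜 V => N ∘ₗ D.subtype)
    (P := fun g => IsAdapted F ν j (LinearMap.ofIsCompl hD2 0 g)) ?_ hfib, hbase, hCr]
  · push_cast
    ring
  · intro N hN
    refine (isAdapted_congr hF fun w hw => ?_).mpr (isAdapted_succ_iff.mp hN).1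
    exact LinearMap.ofIsCompl_apply_right hD2 (φ := 0) (ψ := N ∘ₗ D.subtype) ⟨w, hD1 hw⟩

/-- The powers of Q account for the part of N not yet constrained; they cancel once the flag has
reached V. -/
theorem natCard_isAdapted [Finite 𝕜] {F : ℕ → Submodule 𝕜 V} {ν : ℕ → YoungDiagram}
    (hF : Monotone F) (hF0 : F 0 = ⊥) (hν0 : ν 0 = ⊥) (j : ℕ)
    (hcard : ∀ i, i ≤ j → finrank 𝕜 (F i) = (ν i).card)
    (hstrip : ∀ i < j, IsHorizontalStrip (ν i) (ν (i + 1))) :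
    (Nat.card {N : Module.End 𝕜 V // IsAdapted F ν j N} : ℝ) *
        (Nat.card 𝕜 : ℝ) ^ ((ν j).card * finrank 𝕜 V) =
      (Nat.card 𝕜 : ℝ) ^ (finrank 𝕜 V * finrank 𝕜 V) *
        ∏ i ∈ Finset.range j, extensionCount (Nat.card 𝕜) (ν i) (ν (i + 1)) := by
  induction j with
  | zero =>
    have h1 : ∀ N : Module.End 𝕜 V, IsAdapted F ν 0 N := fun N i hi => absurd hi (Nat.not_lt_zero i)
    have h2 : Nat.card {N : Module.End 𝕜 V // IsAdapted F ν 0 N} =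
        Nat.card 𝕜 ^ (finrank 𝕜 V * finrank 𝕜 V) := by
      rw [Nat.card_congr (Equiv.subtypeUnivEquiv h1)]
      exact natCard_linearMap
    rw [h2, hν0, show (⊥ : YoungDiagram).card = 0 from rfl]
    simp
  | succ j ih =>
    have ih := ih (fun i hi => hcard i (by omega)) (fun i hi => hstrip i (by omega))
    have hstep := natCard_isAdapted_succ hF hF0 hν0 hcard (hstrip j (Nat.lt_succ_self j))
    have hle : (ν j).card ≤ (ν (j + 1)).card := by
      rw [← hcard j (by omega), ← hcard (j + 1) le_rfl]
      exact Submodule.finrank_mono (hF (Nat.le_succ j))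
    rw [Finset.prod_range_succ, ← mul_assoc, ← ih,
      show (ν (j + 1)).card * finrank 𝕜 V = ((ν (j + 1)).card - (ν j).card) * finrank 𝕜 V +
        (ν j).card * finrank 𝕜 V by rw [← add_mul, Nat.sub_add_cancel hle], pow_add, ← mul_assoc,
      hstep]
    ring

end Extensions

/-! ### Evaluating the extension count in q -/

section ExtensionCount

theorem choose_two_add (x y : ℕ) : (x + y).choose 2 = x.choose 2 + y.choose 2 + x * y := by
  induction y with
  | zero => simp
  | succ y ih =>
    rw [← add_assoc, Nat.choose_succ_succ' (x + y) 1, Nat.choose_succ_succ' y 1, ih,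
      Nat.choose_one_right, Nat.choose_one_right]
    ring

theorem choose_two_mul_two_add (r : ℕ) : 2 * r.choose 2 + r = r * r := by
  induction r with
  | zero => rfl
  | succ r ih =>
    rw [Nat.choose_succ_succ' r 1, Nat.choose_one_right]
    linarith

/-- The contribution of one further row. In the notation of `extension_product`, with m = |μ|: b is
the strip size so far, r = l(L+1) - x(L+1), d = x(L) - l(L+1), g = m - x(L) and y = x(L+1), so that
g + d + r + y = m. -/
theorem extension_factor {q : ℝ} (hq : 0 < q) (b r d g y : ℕ) :
    (qBinomial q⁻¹ (b + r) b * ∏ s ∈ Finset.range r, (q⁻¹ ^ (g + (d + r)) - q⁻¹ ^ (g + s))) *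
        (q ^ y.choose 2 * q ^ ((g + d + r + y) * r) * q ^ (b + r).choose 2 * qFactorial q r *
          qFactorial q d * qFactorial q b) =
      qFactorial q (b + r) * q ^ b.choose 2 * q ^ (y + r).choose 2 * (1 - q) ^ r *
        qFactorial q (d + r) := by
  have hQ : 0 < q⁻¹ := inv_pos.mpr hq
  have h1 := prod_pow_sub_pow q⁻¹ g (d + r) r (Nat.le_add_left r d)
  rw [Nat.add_sub_cancel] at h1
  have hQr : (q⁻¹ - 1) ^ r * q ^ r = (1 - q) ^ r := by
    rw [← mul_pow, sub_mul, inv_mul_cancel₀ hq.ne', one_mul]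
  have hQg : q⁻¹ ^ (g * r + r.choose 2) * q ^ (g * r + r.choose 2) = 1 := by
    rw [← mul_pow, inv_mul_cancel₀ hq.ne', one_pow]
  have hb := (qFactorial_pos hQ b).ne'
  have hr := (qFactorial_pos hQ r).ne'
  have hd := (qFactorial_pos hQ d).ne'
  rw [qBinomial, Nat.add_sub_cancel_left, ← qFactorial_inv hq r, ← qFactorial_inv hq d,
    ← qFactorial_inv hq b, ← qFactorial_inv hq (b + r), ← qFactorial_inv hq (d + r), ← hQr]
  set P := ∏ s ∈ Finset.range r, (q⁻¹ ^ (g + (d + r)) - q⁻¹ ^ (g + s))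
  have hexp : q ^ y.choose 2 * q ^ ((g + d + r + y) * r) * q ^ r.choose 2 * q ^ d.choose 2 =
      q ^ (g * r + r.choose 2) * q ^ (y + r).choose 2 * q ^ r * q ^ (d + r).choose 2 := by
    simp only [← pow_add]
    congr 1
    have h2 := choose_two_mul_two_add r
    rw [choose_two_add y r, choose_two_add d r]
    linarith
  clear_value P
  -- From here on Q and q are independent symbols, related only by `hQg`; what remains is a
  -- polynomial identity.
  generalize q⁻¹ = Q at *
  field_simp
  linear_combination qFactorial Q (b + r) * ((q ^ y.choose 2 * q ^ ((g + d + r + y) * r) *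
        q ^ r.choose 2 * q ^ d.choose 2) * h1 +
      Q ^ (g * r + r.choose 2) * (Q - 1) ^ r * qFactorial Q (d + r) * hexp +
      ((Q - 1) ^ r * qFactorial Q (d + r) * q ^ (y + r).choose 2 * q ^ r *
        q ^ (d + r).choose 2) * hQg)

/-- The telescoping evaluation of the product in `extensionCount` over the first rows. -/
theorem extension_product {q : ℝ} (hq : 0 < q) {m : ℕ} {x l b : ℕ → ℕ} (hxm : ∀ i, x i ≤ m)
    (hxl : ∀ i, x i ≤ l i) (hlx : ∀ i, l (i + 1) ≤ x i)
    (hb0 : b 0 = l 0 - x 0) (hb : ∀ i, b (i + 1) = b i + (l (i + 1) - x (i + 1))) (L : ℕ) :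
    (q⁻¹ ^ (b 0 * (m - x 0)) * ∏ i ∈ Finset.range L, (qBinomial q⁻¹ (b (i + 1)) (b i) *
      ∏ s ∈ Finset.range (b (i + 1) - b i), (q⁻¹ ^ (m - x (i + 1)) - q⁻¹ ^ (m - x i + s)))) *
      ((∏ i ∈ Finset.range (L + 1), q ^ (x i).choose 2) * q ^ (m * b L) * q ^ (b L).choose 2 *
        (∏ i ∈ Finset.range (L + 1), qFactorial q (l i - x i)) *
        ∏ i ∈ Finset.range L, qFactorial q (x i - l (i + 1))) * (1 - q) ^ (b 0) =
    qFactorial q (b L) * (∏ i ∈ Finset.range (L + 1), q ^ (l i).choose 2) * (1 - q) ^ b L *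
      ∏ i ∈ Finset.range L, qFactorial q (x i - x (i + 1)) := by
  induction L with
  | zero =>
    -- The first row contributes a bare power of 1/q and no factor 1 - q. The power (1 - q)^(b 0) on
    -- the left compensates for this, and it is the origin of the exponent n - λ_1.
    simp only [Finset.prod_range_zero, zero_add, Finset.prod_range_one, mul_one]
    obtain ⟨g, hg⟩ := Nat.exists_eq_add_of_le (hxm 0)
    obtain ⟨r, hr⟩ := Nat.exists_eq_add_of_le (hxl 0)
    have hbr : b 0 = r := by omega
    have hinv : q⁻¹ ^ (r * g) * q ^ (r * g) = 1 := by
      rw [← mul_pow, inv_mul_cancel₀ hq.ne', one_pow]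
    rw [hbr, hr, show m - x 0 = g by omega, show x 0 + r - x 0 = r by omega, hg, choose_two_add]
    simp only [pow_add, add_mul]
    linear_combination (q ^ (x 0).choose 2 * q ^ (x 0 * r) * q ^ r.choose 2 *
      qFactorial q r * (1 - q) ^ r) * hinv
  | succ L ih =>
    obtain ⟨r, hr⟩ := Nat.exists_eq_add_of_le (hxl (L + 1))
    obtain ⟨d, hd⟩ := Nat.exists_eq_add_of_le (hlx L)
    obtain ⟨g, hg⟩ := Nat.exists_eq_add_of_le (hxm L)
    have hb1 : b (L + 1) = b L + r := by rw [hb]; omega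
    have hfac := extension_factor hq (b L) r d g (x (L + 1))
    rw [Finset.prod_range_succ _ L, Finset.prod_range_succ (fun i => q ^ (x i).choose 2) (L + 1),
      Finset.prod_range_succ (fun i => qFactorial q (l i - x i)) (L + 1),
      Finset.prod_range_succ (fun i => qFactorial q (x i - l (i + 1))) L,
      Finset.prod_range_succ (fun i => q ^ (l i).choose 2) (L + 1),
      Finset.prod_range_succ (fun i => qFactorial q (x i - x (i + 1))) L, hb1,
      show m - x (L + 1) = g + (d + r) by omega, show m - x L = g by omega,
      show b L + r - b L = r by omega, show l (L + 1) - x (L + 1) = r by omega,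
      show x L - l (L + 1) = d by omega, show x L - x (L + 1) = d + r by omega, hr]
    rw [show g + d + r + x (L + 1) = m by omega] at hfac
    have hne1 := (qFactorial_pos hq (b L)).ne'
    have hne2 : q ^ (b L).choose 2 ≠ 0 := (pow_pos hq _).ne'
    -- The factors [b L]_q! and q^(b L choose 2) are what cancels between consecutive rows;
    -- restoring them turns the claim into the product of `ih` and `hfac`.
    apply mul_right_cancel₀ (mul_ne_zero hne1 hne2)
    have h := congrArg₂ (· * ·) ih hfac
    rw [mul_add m, pow_add q (m * b L), pow_add (1 - q) (b L)]
    linear_combination h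

/-- Lets products over the rows of μ and of λ run over a common range. -/
theorem prod_range_colLen {μ : YoungDiagram} {L : ℕ} (hL : μ.rowLen L = 0) {f : ℕ → ℝ}
    (hf : ∀ i, μ.rowLen i = 0 → f i = 1) :
    ∏ i ∈ Finset.range (μ.colLen 0), f i = ∏ i ∈ Finset.range L, f i := by
  have hle : μ.colLen 0 ≤ L := by
    by_contra h
    have := YoungDiagram.mem_iff_lt_rowLen.mp (YoungDiagram.mem_iff_lt_colLen.mpr (not_le.mp h))
    omega
  refine Finset.prod_subset (Finset.range_mono hle) fun i _ hi => hf i ?_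
  exact rowLen_eq_zero_of_le μ (rowLen_colLen_zero μ) (by simpa using hi)

/-- The weight of a horizontal strip `lam / μ`. -/
noncomputable def stripWeight (q : ℝ) (μ lam : YoungDiagram) : ℝ :=
  ∏ i ∈ Finset.range (lam.colLen 0),
    qBinomial q (lam.rowLen i - lam.rowLen (i + 1)) (lam.rowLen i - μ.rowLen i)

/-- The part of the count of endomorphisms of type `μ` that only depends on `μ`. -/
noncomputable def typeFactor (q : ℝ) (μ : YoungDiagram) : ℝ :=
  q ^ nStat μ * (1 - q) ^ (μ.card - μ.rowLen 0) / (q ^ μ.card.choose 2 *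
    ∏ i ∈ Finset.range (μ.colLen 0), qFactorial q (μ.rowLen i - μ.rowLen (i + 1)))

theorem rowLen_le_card (μ : YoungDiagram) (i : ℕ) : μ.rowLen i ≤ μ.card := by
  rw [YoungDiagram.rowLen_eq_card]
  exact Finset.card_le_card (Finset.filter_subset _ _)

theorem IsHorizontalStrip.card_eq {μ lam : YoungDiagram} (h : IsHorizontalStrip μ lam) {L : ℕ}
    (hL : lam.rowLen L = 0) : lam.card = μ.card + stripSum μ lam L := by
  have hμL : μ.rowLen L = 0 := by have := (h L).1; omega
  rw [← sum_rowLen_eq_card lam hL, ← sum_rowLen_eq_card μ hμL, stripSum,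
    Finset.sum_range_succ (fun s => lam.rowLen s - μ.rowLen s), hL, hμL, ← add_assoc,
    ← Finset.sum_add_distrib]
  exact Finset.sum_congr rfl fun s _ => by have := (h s).1; omega

theorem pow_nStat {q : ℝ} {μ : YoungDiagram} {L : ℕ} (hL : μ.rowLen L = 0) :
    q ^ nStat μ = ∏ i ∈ Finset.range L, q ^ (μ.rowLen i).choose 2 := by
  rw [nStat, ← Finset.prod_pow_eq_pow_sum]
  exact prod_range_colLen hL fun i hi => by simp [hi]

/-- The telescoping relation for which `typeFactor` is designed. By `choose_two_add`, the powers of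
q in `extension_product` account for the change of (|μ| choose 2), and its remaining factorials
combine with those of λ into the binomials of the strip weight. -/
theorem extensionCount_mul_typeFactor {q : ℝ} (hq : 0 < q) (hq1 : q < 1) {μ lam : YoungDiagram}
    (h : IsHorizontalStrip μ lam) :
    extensionCount q⁻¹ μ lam * typeFactor q μ =
      qFactorial q (lam.card - μ.card) * typeFactor q lam * stripWeight q μ lam := by
  set L := lam.colLen 0 with hLdef
  have hL : lam.rowLen L = 0 := rowLen_colLen_zero lam
  have hμL : μ.rowLen L = 0 := by have := (h L).1; omega
  have hprod := extension_product hq (rowLen_le_card μ) (fun i => (h i).1) (fun i => (h i).2)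
    (b := stripSum μ lam) (by simp [stripSum]) (fun i => Finset.sum_range_succ _ _) L
  have hcard := h.card_eq hL
  rw [show (q⁻¹ ^ (stripSum μ lam 0 * (μ.card - μ.rowLen 0)) * _) =
      extensionCount q⁻¹ μ lam from rfl,
    Finset.prod_range_succ (fun i => q ^ (μ.rowLen i).choose 2), ← pow_nStat hμL,
    Finset.prod_range_succ (fun i => q ^ (lam.rowLen i).choose 2), ← pow_nStat hL,
    Finset.prod_range_succ (fun i => qFactorial q (lam.rowLen i - μ.rowLen i)), hL, hμL,
    Nat.sub_zero, qFactorial_zero, Nat.choose_zero_succ, pow_zero, mul_one, mul_one, mul_one]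
    at hprod
  -- The lower entries of the binomial in row i are λ_i - μ_i and μ_i - λ_{i+1}, which add up to λ_i
  -- - λ_{i+1}.
  have hw : stripWeight q μ lam *
      ((∏ i ∈ Finset.range L, qFactorial q (lam.rowLen i - μ.rowLen i)) *
      ∏ i ∈ Finset.range L, qFactorial q (μ.rowLen i - lam.rowLen (i + 1))) =
      ∏ i ∈ Finset.range L, qFactorial q (lam.rowLen i - lam.rowLen (i + 1)) := by
    rw [stripWeight, ← Finset.prod_mul_distrib, ← Finset.prod_mul_distrib]
    refine Finset.prod_congr rfl fun i _ => ?_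
    have h1 := h i
    have h2 := (qFactorial_pos hq (lam.rowLen i - μ.rowLen i)).ne'
    have h3 := (qFactorial_pos hq (μ.rowLen i - lam.rowLen (i + 1))).ne'
    rw [qBinomial, show lam.rowLen i - lam.rowLen (i + 1) - (lam.rowLen i - μ.rowLen i) =
      μ.rowLen i - lam.rowLen (i + 1) by omega]
    field_simp
  -- Both exponents equal |λ| - μ_1.
  have hb : (1 - q) ^ (lam.card - lam.rowLen 0) * (1 - q) ^ stripSum μ lam 0 =
      (1 - q) ^ (μ.card - μ.rowLen 0) * (1 - q) ^ stripSum μ lam L := by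
    rw [← pow_add, ← pow_add]
    congr 1
    have h1 := rowLen_le_card lam 0
    have h2 := rowLen_le_card μ 0
    have h3 := (h 0).1
    simp only [stripSum, zero_add, Finset.sum_range_one] at hcard ⊢
    omega
  rw [typeFactor, typeFactor, prod_range_colLen hμL (fun i hi => by
    rw [hi, Nat.zero_sub, qFactorial_zero]), ← hLdef, hcard, Nat.add_sub_cancel_left,
    choose_two_add, ← hcard, pow_add, pow_add]
  have hpos : ∀ (f : ℕ → ℕ) (n : ℕ), ∏ i ∈ Finset.range n, qFactorial q (f i) ≠ 0 := fun f n =>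
    (Finset.prod_pos fun i _ => qFactorial_pos hq (f i)).ne'
  have p1 := hpos (fun i => lam.rowLen i - μ.rowLen i) L
  have p2 := hpos (fun i => μ.rowLen i - lam.rowLen (i + 1)) L
  have p3 := hpos (fun i => lam.rowLen i - lam.rowLen (i + 1)) L
  have p4 := hpos (fun i => μ.rowLen i - μ.rowLen (i + 1)) L
  have p5 : (1 - q) ^ stripSum μ lam 0 ≠ 0 := pow_ne_zero _ (by linarith)
  rw [← hw] at p3 ⊢
  have p6 := left_ne_zero_of_mul p3
  set A := ∏ i ∈ Finset.range L, qFactorial q (lam.rowLen i - μ.rowLen i)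
  set B := ∏ i ∈ Finset.range L, qFactorial q (μ.rowLen i - lam.rowLen (i + 1))
  set D := ∏ i ∈ Finset.range L, qFactorial q (μ.rowLen i - μ.rowLen (i + 1))
  set E := extensionCount q⁻¹ μ lam
  field_simp
  apply mul_right_cancel₀ p5
  clear_value A B D E
  generalize (1 - q) ^ (lam.card - lam.rowLen 0) = c1 at *
  generalize (1 - q) ^ (μ.card - μ.rowLen 0) = c2 at *
  linear_combination c2 * hprod - qFactorial q (stripSum μ lam L) * q ^ nStat lam * D * hb

theorem typeFactor_bot (q : ℝ) : typeFactor q ⊥ = 1 := by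
  have h : (⊥ : YoungDiagram).colLen 0 = 0 := by
    by_contra h
    exact YoungDiagram.notMem_bot _ (YoungDiagram.mem_iff_lt_colLen.mpr (Nat.pos_of_ne_zero h))
  simp [typeFactor, nStat, h, show (⊥ : YoungDiagram).card = 0 from rfl]

theorem prod_extensionCount {q : ℝ} (hq : 0 < q) (hq1 : q < 1) {ν : ℕ → YoungDiagram}
    (hν0 : ν 0 = ⊥) (j : ℕ) (h : ∀ i < j, IsHorizontalStrip (ν i) (ν (i + 1))) :
    ∏ i ∈ Finset.range j, extensionCount q⁻¹ (ν i) (ν (i + 1)) =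
      typeFactor q (ν j) * (∏ i ∈ Finset.range j, qFactorial q ((ν (i + 1)).card - (ν i).card)) *
        ∏ i ∈ Finset.range j, stripWeight q (ν i) (ν (i + 1)) := by
  induction j with
  | zero => simp [hν0, typeFactor_bot]
  | succ j ih =>
    have h1 := extensionCount_mul_typeFactor hq hq1 (h j (Nat.lt_succ_self j))
    rw [Finset.prod_range_succ, Finset.prod_range_succ, Finset.prod_range_succ,
      ih fun i hi => h i (by omega)]
    linear_combination ((∏ i ∈ Finset.range j, qFactorial q ((ν (i + 1)).card - (ν i).card)) *
        ∏ i ∈ Finset.range j, stripWeight q (ν i) (ν (i + 1))) * h1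

end ExtensionCount

/-! ### Counting partial flags -/

section FlagCounting

variable {𝕜 : Type*} [Field 𝕜]

/-- The condition that `F` is a flag ending in `U` whose steps have dimensions `a 0, a 1, …`. -/
def IsFlagIn {V : Type*} [AddCommGroup V] [Module 𝕜 V] (a : ℕ → ℕ) (k : ℕ) (U : Submodule 𝕜 V)
    (F : Fin (k + 1) → Submodule 𝕜 V) : Prop :=
  Monotone F ∧ F (Fin.last k) = U ∧ ∀ i, finrank 𝕜 (F i) = ∑ j ∈ Finset.range i, a j

theorem isFlagIn_succ_iff {V : Type*} [AddCommGroup V] [Module 𝕜 V] {a : ℕ → ℕ} {k : ℕ}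
    {U : Submodule 𝕜 V} {F : Fin (k + 2) → Submodule 𝕜 V} :
    IsFlagIn a (k + 1) U F ↔ IsFlagIn a k (F (Fin.last k).castSucc) (fun i => F i.castSucc) ∧
      F (Fin.last k).castSucc ≤ U ∧ F (Fin.last (k + 1)) = U ∧
        finrank 𝕜 U = ∑ j ∈ Finset.range (k + 1), a j := by
  constructor
  · rintro ⟨hmono, rfl, hdim⟩
    refine ⟨⟨hmono.comp (Fin.strictMono_castSucc).monotone, rfl, fun i => hdim i.castSucc⟩,
      hmono (Fin.le_last _), rfl, hdim (Fin.last (k + 1))⟩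
  · rintro ⟨⟨hmono, -, hdim⟩, hle, rfl, hU⟩
    refine ⟨Fin.monotone_iff_le_succ.mpr fun i => ?_, rfl, fun i => ?_⟩
    · induction i using Fin.lastCases with
      | last => exact hle
      | cast i => exact hmono (Fin.castSucc_lt_succ (i := i)).le
    · induction i using Fin.lastCases with
      | last => exact hU
      | cast i => exact hdim i

/-- Fibre over the last step but one, a subspace K of U: what remains is a shorter flag ending in K.
The end U therefore has to vary in the induction. -/
theorem natCard_isFlagIn [Finite 𝕜] {V : Type*} [AddCommGroup V] [Module 𝕜 V]
    [FiniteDimensional 𝕜 V] (a : ℕ → ℕ) (k : ℕ) :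
    ∀ U : Submodule 𝕜 V, finrank 𝕜 U = ∑ j ∈ Finset.range k, a j →
    (Nat.card {F : Fin (k + 1) → Submodule 𝕜 V // IsFlagIn a k U F} : ℝ) =
      qFactorial (Nat.card 𝕜) (∑ j ∈ Finset.range k, a j) /
        ∏ j ∈ Finset.range k, qFactorial (Nat.card 𝕜) (a j) := by
  have hQ : (0 : ℝ) < Nat.card 𝕜 := by exact_mod_cast Nat.card_pos
  have hfin := finite_submodule (𝕜 := 𝕜) (V := V)
  induction k with
  | zero =>
    intro U hU
    have : Unique {F : Fin (0 + 1) → Submodule 𝕜 V // IsFlagIn a 0 U F} :=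
      { default := ⟨fun _ => U, fun _ _ _ => le_rfl, rfl, fun i => by
          rw [hU, show (i : ℕ) = 0 by omega]⟩
        uniq := fun F => by
          refine Subtype.ext (funext fun i => ?_)
          rw [show i = Fin.last 0 from Fin.ext (by omega)]
          exact F.2.2.1 }
    simp [qFactorial_zero]
  | succ k ih =>
    intro U hU
    rw [natCard_subtype_eq_mul
      (fun F : Fin (k + 2) → Submodule 𝕜 V => F (Fin.last k).castSucc)
      (P := fun K => K ≤ U ∧ finrank 𝕜 K = ∑ j ∈ Finset.range k, a j)
      (c := qFactorial (Nat.card 𝕜) (∑ j ∈ Finset.range k, a j) /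
        ∏ j ∈ Finset.range k, qFactorial (Nat.card 𝕜) (a j))]
    · have hK : (Nat.card {K : Submodule 𝕜 V // K ≤ U ∧
          finrank 𝕜 K = ∑ j ∈ Finset.range k, a j} : ℝ) =
          qBinomial (Nat.card 𝕜) (∑ j ∈ Finset.range (k + 1), a j)
            (∑ j ∈ Finset.range k, a j) := by
        rw [← hU, ← natCard_submodule (by rw [hU, Finset.sum_range_succ]; omega)]
        congr 1
        symm
        refine Nat.card_congr (((Submodule.MapSubtype.orderIso U).toEquiv.subtypeEquiv
          (q := fun K => finrank 𝕜 K.1 = ∑ j ∈ Finset.range k, a j) fun K => ?_).trans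
          (Equiv.subtypeSubtypeEquivSubtypeInter (fun K => K ≤ U)
            (fun K => finrank 𝕜 K = ∑ j ∈ Finset.range k, a j)))
        rw [← Submodule.finrank_map_subtype_eq]
        rfl
      rw [hK, qBinomial, Finset.sum_range_succ, Nat.add_sub_cancel_left, Finset.prod_range_succ]
      have h1 := (qFactorial_pos hQ (∑ j ∈ Finset.range k, a j)).ne'
      have h2 := (qFactorial_pos hQ (a k)).ne'
      have h3 : ∏ j ∈ Finset.range k, qFactorial (Nat.card 𝕜) (a j) ≠ 0 :=
        (Finset.prod_pos fun i _ => qFactorial_pos hQ (a i)).ne'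
      field_simp
    · intro F hF
      have h := isFlagIn_succ_iff.mp hF
      exact ⟨h.2.1, h.1.2.2 (Fin.last k)⟩
    · rintro K ⟨hKU, hK⟩
      rw [← ih K hK]
      congr 1
      refine Nat.card_congr
        { toFun := fun F => ⟨fun i => F.1 i.castSucc, by
            have h := (isFlagIn_succ_iff.mp F.2.1).1
            rwa [F.2.2] at h⟩
          invFun := fun F => ⟨Fin.snoc F.1 U, by
            have hF := F.2
            have hlast := F.2.2.1
            refine ⟨isFlagIn_succ_iff.mpr ?_, by simpa using hlast⟩
            simp only [Fin.snoc_castSucc, Fin.snoc_last]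
            exact ⟨hlast.symm ▸ hF, hlast.symm ▸ hKU, trivial, hU⟩⟩
          left_inv := ?_
          right_inv := ?_ }
      · rintro ⟨F, hF, rfl⟩
        refine Subtype.ext ?_
        have h := (isFlagIn_succ_iff.mp hF).2.2.1
        change Fin.snoc (fun i : Fin (k + 1) => F i.castSucc) U = F
        rw [← h]
        exact Fin.snoc_init_self F
      · rintro ⟨F, hF⟩
        refine Subtype.ext (funext fun i => ?_)
        simp

/-- The parts of a weak composition as a sequence, extended by zeros. -/
def compPart {k : ℕ} (α : Fin k → ℕ) (j : ℕ) : ℕ := if h : j < k then α ⟨j, h⟩ else 0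

theorem compPart_fin {k : ℕ} (α : Fin k → ℕ) (j : Fin k) : compPart α j = α j := by
  simp [compPart]

theorem sum_compPart {k : ℕ} (α : Fin k → ℕ) {i : ℕ} (hi : i ≤ k) :
    ∑ j ∈ Finset.range i, compPart α j =
      ∑ j ∈ Finset.univ.filter (fun j : Fin k => (j : ℕ) < i), α j := by
  rw [Finset.sum_filter]
  simp only [← compPart_fin α]
  rw [← Finset.sum_range (fun j => if j < i then compPart α j else 0), ← Finset.sum_filter]
  congr 1
  ext j
  simp only [Finset.mem_range, Finset.mem_filter]
  omega

theorem sum_compPart_eq {k : ℕ} (α : Fin k → ℕ) :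
    ∑ j ∈ Finset.range k, compPart α j = ∑ i, α i := by
  rw [Finset.sum_range]
  simp only [compPart_fin]

/-- Partial flags as functions. -/
def partialFlagEquiv (𝕜 : Type*) [Field 𝕜] (n : ℕ) {k : ℕ} (α : Fin k → ℕ) (hα : ∑ i, α i = n) :
    PartialFlag 𝕜 n α ≃
      {F : Fin (k + 1) → Submodule 𝕜 (Fin n → 𝕜) // IsFlagIn (compPart α) k ⊤ F} where
  toFun F := ⟨F.space, F.mono, by
    refine Submodule.eq_top_of_finrank_eq ?_
    rw [F.finrank_space, ← sum_compPart α (Nat.le_of_lt_succ (Fin.last k).2), Fin.val_last,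
      sum_compPart_eq, hα, finrank_fin_fun], fun i => by
    rw [F.finrank_space, sum_compPart α (Nat.le_of_lt_succ i.2)]⟩
  invFun F := ⟨F.1, F.2.1, fun i => by
    rw [F.2.2.2, sum_compPart α (Nat.le_of_lt_succ i.2)]⟩
  left_inv _ := rfl
  right_inv _ := rfl

theorem finite_partialFlag [Finite 𝕜] (n : ℕ) {k : ℕ} (α : Fin k → ℕ) :
    Finite (PartialFlag 𝕜 n α) := by
  have := finite_submodule (𝕜 := 𝕜) (V := Fin n → 𝕜)
  exact Finite.of_injective PartialFlag.space fun _ _ h => PartialFlag.ext h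

/-- The Q-multinomial coefficient rewritten in q; inverting each factorial produces the powers (n
choose 2) and n(α). -/
theorem natCard_partialFlag [Finite 𝕜] {q : ℝ} (hq : q⁻¹ = Nat.card 𝕜) (n : ℕ) {k : ℕ}
    (α : Fin k → ℕ) (hα : ∑ i, α i = n) :
    (Nat.card (PartialFlag 𝕜 n α) : ℝ) * q ^ n.choose 2 * ∏ i, qFactorial q (α i) =
      q ^ nStatComp α * qFactorial q n := by
  have hQ : (0 : ℝ) < q⁻¹ := by rw [hq]; exact_mod_cast Nat.card_pos
  have hq0 : 0 < q := inv_pos.mp hQ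
  have hsum := sum_compPart_eq α
  rw [Nat.card_congr (partialFlagEquiv 𝕜 n α hα), natCard_isFlagIn _ _ _ (by
    rw [finrank_top, finrank_fin_fun, hsum, hα]), hsum, hα, ← hq, Finset.prod_range, nStatComp,
    ← Finset.prod_pow_eq_pow_sum, ← qFactorial_inv hq0 n]
  simp only [compPart_fin]
  have h : ∏ i, qFactorial q (α i) =
      (∏ i, qFactorial q⁻¹ (α i)) * ∏ i, q ^ (α i).choose 2 := by
    rw [← Finset.prod_mul_distrib]
    exact Finset.prod_congr rfl fun i _ => (qFactorial_inv hq0 _).symm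
  rw [h]
  have h3 : ∏ i, qFactorial q⁻¹ (α i) ≠ 0 := (Finset.prod_pos fun i _ => qFactorial_pos hQ _).ne'
  generalize ∏ i, qFactorial q⁻¹ (α i) = A at *
  field_simp

end FlagCounting

/-! ### Jordan type and dimensions of kernels of powers -/

section JordanType

variable {𝕜 : Type*} [Field 𝕜] {V : Type*} [AddCommGroup V] [Module 𝕜 V]

/-- The index type of a Jordan basis with one block for each row of `ν`. -/
abbrev JordanIndex (ν : YoungDiagram) : Type := (c : Fin (ν.colLen 0)) × Fin (ν.rowLen c)

/-- The indices of a Jordan basis are the cells of the diagram. -/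
def jordanIndexEquiv (ν : YoungDiagram) : JordanIndex ν ≃ {c : ℕ × ℕ // c ∈ ν.cells} where
  toFun x := ⟨(x.1, x.2), YoungDiagram.mem_iff_lt_rowLen.mpr x.2.2⟩
  invFun c := ⟨⟨c.1.1, YoungDiagram.mem_iff_lt_colLen.mp
      (ν.up_left_mem le_rfl (Nat.zero_le _) c.2)⟩,
    ⟨c.1.2, YoungDiagram.mem_iff_lt_rowLen.mp c.2⟩⟩
  left_inv _ := rfl
  right_inv _ := rfl

theorem card_jordanIndex (ν : YoungDiagram) : Fintype.card (JordanIndex ν) = ν.card := by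
  rw [Fintype.card_congr (jordanIndexEquiv ν), Fintype.card_coe]

theorem card_jordanIndex_lt (ν : YoungDiagram) (i : ℕ) :
    Fintype.card {x : JordanIndex ν // (x.2 : ℕ) < i} = ∑ p ∈ Finset.range i, ν.colLen p := by
  have h : Fintype.card {x : JordanIndex ν // (x.2 : ℕ) < i} =
      (ν.cells.filter fun c => c.2 < i).card := by
    rw [← Fintype.card_coe]
    refine Fintype.card_congr (((jordanIndexEquiv ν).subtypeEquiv
      (q := fun c => c.1.2 < i) fun x => Iff.rfl).trans
      ((Equiv.subtypeSubtypeEquivSubtypeInter (fun c => c ∈ ν.cells) (fun c => c.2 < i)).trans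
        (Equiv.subtypeEquivRight fun c => ?_)))
    rw [Finset.mem_filter]
  rw [h, Finset.card_eq_sum_card_fiberwise (f := Prod.snd) (t := Finset.range i)]
  · refine Finset.sum_congr rfl fun p hp => ?_
    rw [YoungDiagram.colLen_eq_card, YoungDiagram.col, Finset.filter_filter]
    congr 1
    ext c
    simp only [Finset.mem_filter, and_congr_right_iff, and_iff_right_iff_imp]
    rintro - rfl
    exact Finset.mem_range.mp hp
  · intro c hc
    simpa using (Finset.mem_filter.mp hc).2

/-- The ones lie above the diagonal, so N moves a basis vector one place back in its block and kills
the vector at position 0. -/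
theorem sum_jordanMatrix_smul {ν : YoungDiagram} (b : JordanIndex ν → V) (x : JordanIndex ν) :
    ∑ y, jordanMatrix 𝕜 ν y x • b y =
      if 0 < (x.2 : ℕ) then b ⟨x.1, ⟨x.2 - 1, by omega⟩⟩ else 0 := by
  obtain ⟨c, p⟩ := x
  split_ifs with h
  · rw [Finset.sum_eq_single ⟨c, ⟨p - 1, by omega⟩⟩]
    · rw [jordanMatrix, Matrix.blockDiagonal'_apply_eq, jordanBlock, Matrix.of_apply, if_pos,
        one_smul]
      exact Nat.sub_add_cancel h
    · rintro ⟨c', p'⟩ - hne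
      by_cases hc : c' = c
      · subst hc
        rw [jordanMatrix, Matrix.blockDiagonal'_apply_eq, jordanBlock, Matrix.of_apply, if_neg,
          zero_smul]
        rintro h'
        apply hne
        congr 1
        ext
        simp only at h' ⊢
        omega
      · rw [jordanMatrix, Matrix.blockDiagonal'_apply_ne _ _ _ hc, zero_smul]
    · exact fun h => absurd (Finset.mem_univ _) h
  · refine Finset.sum_eq_zero ?_
    rintro ⟨c', p'⟩ -
    by_cases hc : c' = c
    · subst hc
      rw [jordanMatrix, Matrix.blockDiagonal'_apply_eq, jordanBlock, Matrix.of_apply, if_neg,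
        zero_smul]
      simp only at h
      omega
    · rw [jordanMatrix, Matrix.blockDiagonal'_apply_ne _ _ _ hc, zero_smul]

theorem toMatrix_eq_jordanMatrix_iff {ν : YoungDiagram} (b : Basis (JordanIndex ν) 𝕜 V)
    (N : Module.End 𝕜 V) : LinearMap.toMatrix b b N = jordanMatrix 𝕜 ν ↔
      ∀ x : JordanIndex ν, N (b x) =
        if 0 < (x.2 : ℕ) then b ⟨x.1, ⟨x.2 - 1, by omega⟩⟩ else 0 := by
  constructor
  · intro h x
    have hN : N = Matrix.toLin b b (jordanMatrix 𝕜 ν) := by rw [← h, Matrix.toLin_toMatrix]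
    rw [hN, Matrix.toLin_self, sum_jordanMatrix_smul]
  · intro h
    have hN : N = Matrix.toLin b b (jordanMatrix 𝕜 ν) :=
      b.ext fun x => by rw [h, Matrix.toLin_self, sum_jordanMatrix_smul]
    rw [hN, LinearMap.toMatrix_toLin]

theorem card_le_finrank_of_mem [FiniteDimensional 𝕜 V] {ι : Type*} [Fintype ι] {v : ι → V}
    (hv : LinearIndependent 𝕜 v) {U : Submodule 𝕜 V} (h : ∀ i, v i ∈ U) :
    Fintype.card ι ≤ finrank 𝕜 U := by
  have : LinearIndependent 𝕜 (fun i => (⟨v i, h i⟩ : U)) :=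
    LinearIndependent.of_comp U.subtype hv
  exact this.fintype_card_le_finrank

theorem pow_jordan_apply {ν : YoungDiagram} {b : JordanIndex ν → V} {N : Module.End 𝕜 V}
    (h : ∀ x : JordanIndex ν, N (b x) =
        if 0 < (x.2 : ℕ) then b ⟨x.1, ⟨x.2 - 1, by omega⟩⟩ else 0) (i : ℕ) (x : JordanIndex ν) :
    (N ^ i) (b x) = if i ≤ (x.2 : ℕ) then b ⟨x.1, ⟨x.2 - i, by omega⟩⟩ else 0 := by
  induction i with
  | zero => simp
  | succ i ih =>
    rw [pow_succ', Module.End.mul_apply, ih]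
    by_cases h1 : i ≤ (x.2 : ℕ)
    · rw [if_pos h1, h]
      simp only [Nat.sub_pos_iff_lt, Nat.succ_le_iff, Nat.sub_sub]
    · rw [if_neg h1, if_neg (by omega), map_zero]

/-- Basis vectors at positions below i lie in the kernel, and the others are carried to independent
vectors of the range. By rank-nullity these two lower bounds are equalities. -/
theorem finrank_ker_pow_of_jordan [FiniteDimensional 𝕜 V] {ν : YoungDiagram}
    (b : Basis (JordanIndex ν) 𝕜 V) {N : Module.End 𝕜 V}
    (h : LinearMap.toMatrix b b N = jordanMatrix 𝕜 ν) (i : ℕ) :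
    finrank 𝕜 (LinearMap.ker (N ^ i)) = ∑ p ∈ Finset.range i, ν.colLen p := by
  have hN := pow_jordan_apply ((toMatrix_eq_jordanMatrix_iff b N).mp h) i
  have hker : Fintype.card {x : JordanIndex ν // (x.2 : ℕ) < i} ≤
      finrank 𝕜 (LinearMap.ker (N ^ i)) := by
    refine card_le_finrank_of_mem
      (b.linearIndependent.comp (fun x : {x : JordanIndex ν // (x.2 : ℕ) < i} => x.1)
        Subtype.val_injective) fun x => ?_
    rw [LinearMap.mem_ker, Function.comp_apply, hN, if_neg (not_le.mpr x.2)]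
  have hrange : Fintype.card {x : JordanIndex ν // ¬ (x.2 : ℕ) < i} ≤
      finrank 𝕜 (LinearMap.range (N ^ i)) := by
    refine card_le_finrank_of_mem
      (b.linearIndependent.comp (fun x : {x : JordanIndex ν // ¬ (x.2 : ℕ) < i} =>
        (⟨x.1.1, ⟨x.1.2 - i, by omega⟩⟩ : JordanIndex ν)) ?_) fun x => ?_
    · rintro ⟨⟨c, p⟩, hp⟩ ⟨⟨c', p'⟩, hp'⟩ heq
      simp only [Sigma.mk.injEq] at heq
      obtain ⟨rfl, heq⟩ := heq
      simp only [heq_eq_eq, Fin.mk.injEq] at heq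
      simp only [not_lt] at hp hp'
      have : p = p' := Fin.ext (by omega)
      subst this
      rfl
    · refine ⟨b x.1, ?_⟩
      rw [hN, if_pos (not_lt.mp x.2)]
      rfl
  have hsum := Fintype.card_subtype_compl (fun x : JordanIndex ν => (x.2 : ℕ) < i)
  have hle := Fintype.card_subtype_le (fun x : JordanIndex ν => (x.2 : ℕ) < i)
  have hV := finrank_eq_card_basis b
  have hrn := (N ^ i).finrank_range_add_finrank_ker
  rw [← card_jordanIndex_lt]
  omega

theorem exists_extend_linearIndependent [FiniteDimensional 𝕜 V] (U : Submodule 𝕜 V) {m : ℕ}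
    {u : ℕ → V} (hu : LinearIndependent 𝕜 fun c : Fin m => u c) (hU : ∀ c < m, u c ∈ U) (t : ℕ)
    (ht : m + t ≤ finrank 𝕜 U) : ∃ u' : ℕ → V, (∀ c < m, u' c = u c) ∧
      (LinearIndependent 𝕜 fun c : Fin (m + t) => u' c) ∧ ∀ c < m + t, u' c ∈ U := by
  induction t with
  | zero => exact ⟨u, fun _ _ => rfl, hu, hU⟩
  | succ t ih =>
    obtain ⟨u₁, h1, h2, h3⟩ := ih (by omega)
    have h2' : LinearIndependent 𝕜 fun c : Fin (m + t) => (⟨u₁ c, h3 c c.2⟩ : U) :=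
      LinearIndependent.of_comp U.subtype h2
    obtain ⟨x, hx⟩ := exists_linearIndependent_snoc_of_lt_finrank h2' (by omega)
    refine ⟨Function.update u₁ (m + t) x, fun c hc => ?_, ?_, fun c hc => ?_⟩
    · rw [Function.update_of_ne (by omega), h1 c hc]
    · have hx' := hx.map' U.subtype U.ker_subtype
      have heq : (fun c : Fin (m + t + 1) => Function.update u₁ (m + t) (x : V) c) =
          U.subtype ∘ Fin.snoc (fun c : Fin (m + t) => (⟨u₁ c, h3 c c.2⟩ : U)) x := by
        funext c
        induction c using Fin.lastCases with
        | last => simp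
        | cast c =>
          have : (c : ℕ) ≠ m + t := by omega
          simp [Function.update_of_ne this]
      exact heq.symm ▸ hx'
    · rcases Nat.lt_succ_iff_lt_or_eq.mp (show c < (m + t) + 1 from hc) with hc | rfl
      · rw [Function.update_of_ne (by omega)]
        exact h3 c hc
      · rw [Function.update_self]
        exact x.2

/-- A basis adapted to a decreasing filtration with prescribed dimensions. -/
theorem exists_adapted_linearIndependent [FiniteDimensional 𝕜 V] {K : ℕ → Submodule 𝕜 V}
    (hK : Antitone K) {x : ℕ → ℕ} (hx : ∀ p, finrank 𝕜 (K p) = x p) {L : ℕ} (hL : x L = 0) :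
    ∃ u : ℕ → V, (LinearIndependent 𝕜 fun c : Fin (x 0) => u c) ∧ ∀ p, ∀ c < x p, u c ∈ K p := by
  have hanti : ∀ p p', p ≤ p' → x p' ≤ x p := fun p p' h => by
    rw [← hx, ← hx]
    exact Submodule.finrank_mono (hK h)
  -- Downward induction along the filtration: start with the empty family in K L = 0 and enlarge it
  -- at each earlier step.
  have key : ∀ m, m ≤ L → ∃ u : ℕ → V, (LinearIndependent 𝕜 fun c : Fin (x (L - m)) => u c) ∧
      ∀ p, L - m ≤ p → ∀ c < x p, u c ∈ K p := by
    intro m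
    induction m with
    | zero =>
      intro _
      refine ⟨fun _ => 0, ?_, fun p hp c hc => ?_⟩
      · have : IsEmpty (Fin (x (L - 0))) := by
          rw [Nat.sub_zero, hL]
          infer_instance
        exact linearIndependent_empty_type
      · have := hanti L p (by omega)
        omega
    | succ m ih =>
      intro hm
      obtain ⟨u, h1, h2⟩ := ih (by omega)
      have hle := hanti (L - (m + 1)) (L - m) (by omega)
      obtain ⟨u', h3, h4, h5⟩ := exists_extend_linearIndependent (K (L - (m + 1))) h1
        (fun c hc => hK (by omega) (h2 _ le_rfl c hc)) (x (L - (m + 1)) - x (L - m))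
        (by rw [hx]; omega)
      rw [Nat.add_sub_cancel' hle] at h4 h5
      refine ⟨u', h4, fun p hp c hc => ?_⟩
      rcases Nat.lt_or_ge p (L - m) with hlt | hge
      · obtain rfl : p = L - (m + 1) := by omega
        exact h5 c hc
      · rw [h3 c (hc.trans_le (hanti _ _ hge))]
        exact h2 p hge c hc
  obtain ⟨u, h1, h2⟩ := key L le_rfl
  rw [Nat.sub_self] at h1 h2
  exact ⟨u, h1, fun p => h2 p (Nat.zero_le p)⟩

/-- Apply N^p to a relation, with p the largest position that has a nonzero coefficient: lower
positions are killed, higher ones have coefficient zero, and position p gives a relation among the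
independent vectors u. -/
theorem linearIndependent_of_pow {ν : YoungDiagram} {v : JordanIndex ν → V} {N : Module.End 𝕜 V}
    {u : Fin (ν.colLen 0) → V} (hu : LinearIndependent 𝕜 u)
    (h0 : ∀ x : JordanIndex ν, (N ^ (x.2 : ℕ)) (v x) = u x.1)
    (h1 : ∀ (x : JordanIndex ν) (i : ℕ), (x.2 : ℕ) < i → (N ^ i) (v x) = 0) :
    LinearIndependent 𝕜 v := by
  classical
  rw [Fintype.linearIndependent_iff]
  intro a ha
  by_contra! hne
  obtain ⟨x₁, hx₁⟩ := hne
  obtain ⟨x₀, hx₀, hmax⟩ := Finset.exists_max_image (Finset.univ.filter fun x => a x ≠ 0)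
    (fun x : JordanIndex ν => (x.2 : ℕ)) ⟨x₁, by simpa using hx₁⟩
  obtain ⟨c₀, p₀⟩ := x₀
  have hx₀ : a ⟨c₀, p₀⟩ ≠ 0 := by simpa using hx₀
  have hterm : ∀ x : JordanIndex ν, a x • (N ^ (p₀ : ℕ)) (v x) =
      (if (x.2 : ℕ) = p₀ then a x else 0) • u x.1 := by
    intro x
    rcases lt_trichotomy (x.2 : ℕ) p₀ with h | h | h
    · rw [h1 x _ h, smul_zero, if_neg h.ne, zero_smul]
    · rw [if_pos h, ← h, h0]
    · have : a x = 0 := by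
        by_contra hax
        have := hmax x (by simpa using hax)
        simp only at this
        omega
      rw [this, zero_smul, if_neg h.ne', zero_smul]
  have hsum := congrArg (N ^ (p₀ : ℕ)) ha
  rw [map_sum, map_zero] at hsum
  simp only [map_smul, hterm] at hsum
  rw [Fintype.sum_sigma] at hsum
  simp only [← Finset.sum_smul] at hsum
  have hzero := Fintype.linearIndependent_iff.mp hu _ hsum c₀
  rw [Finset.sum_eq_single p₀] at hzero
  · rw [if_pos rfl] at hzero
    exact hx₀ hzero
  · intro p _ hp
    exact if_neg fun h => hp (Fin.ext h)
  · exact fun h => absurd (Finset.mem_univ _) h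

/-- For the converse, a Jordan basis is built from the bottom: a basis of ker N adapted to the
subspaces ker N ∩ im N^p is lifted as far as possible, each lift giving one block. The chains are
independent, and their total length |μ| is the dimension. -/
theorem hasJordanType_iff [FiniteDimensional 𝕜 V] {N : Module.End 𝕜 V} {μ : YoungDiagram}
    (hV : finrank 𝕜 V = μ.card) : HasJordanType N μ ↔
      ∀ i, finrank 𝕜 (LinearMap.ker (N ^ i)) = ∑ s ∈ Finset.range i, μ.rowLen s := by
  constructor
  · rintro ⟨b, hb⟩ i
    rw [finrank_ker_pow_of_jordan b hb]
    simp only [YoungDiagram.colLen_transpose]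
  · intro h
    -- N^p maps ker N^(p+1) onto ker N ∩ im N^p, with kernel ker N^p.
    have hfin : ∀ p, finrank 𝕜 (LinearMap.ker N ⊓ LinearMap.range (N ^ p) : Submodule 𝕜 V) =
        μ.rowLen p := by
      intro p
      have h1 := finrank_map_add_finrank_inf_ker (N ^ p) (LinearMap.ker (N ^ (p + 1)))
      have h2 : (LinearMap.ker (N ^ (p + 1))).map (N ^ p) =
          LinearMap.ker N ⊓ LinearMap.range (N ^ p) := by
        ext v
        simp only [Submodule.mem_map, LinearMap.mem_ker, Submodule.mem_inf, LinearMap.mem_range]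
        constructor
        · rintro ⟨w, hw, rfl⟩
          rw [pow_succ', Module.End.mul_apply] at hw
          exact ⟨hw, w, rfl⟩
        · rintro ⟨hv, w, rfl⟩
          refine ⟨w, ?_, rfl⟩
          rw [pow_succ', Module.End.mul_apply]
          exact hv
      have h3 : LinearMap.ker (N ^ (p + 1)) ⊓ LinearMap.ker (N ^ p) = LinearMap.ker (N ^ p) :=
        inf_eq_right.mpr (ker_pow_mono N (Nat.le_succ p))
      rw [h2, h3, h, h, Finset.sum_range_succ] at h1
      omega
    have hanti : Antitone fun p => LinearMap.ker N ⊓ LinearMap.range (N ^ p) := by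
      refine antitone_nat_of_succ_le fun p => inf_le_inf_left _ ?_
      rintro _ ⟨w, rfl⟩
      exact ⟨N w, by rw [pow_succ, Module.End.mul_apply]⟩
    obtain ⟨u, hu, huK⟩ := exists_adapted_linearIndependent hanti hfin (rowLen_colLen_zero μ)
    -- The vector u c lies in im N^p whenever cell (p, c) is in μ; the last such p is the length of
    -- column c minus one.
    have hheight : ∀ c : Fin (μ.transpose.colLen 0),
        ∃ w, (N ^ (μ.transpose.rowLen c - 1)) w = u c := by
      intro c
      have hc : (c : ℕ) < μ.rowLen 0 :=
        lt_of_lt_of_eq c.2 (YoungDiagram.colLen_transpose μ 0)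
      have hc' : 0 < μ.colLen c :=
        YoungDiagram.mem_iff_lt_colLen.mp (YoungDiagram.mem_iff_lt_rowLen.mpr hc)
      rw [YoungDiagram.rowLen_transpose]
      refine (huK (μ.colLen c - 1) c (YoungDiagram.mem_iff_lt_rowLen.mp
        (YoungDiagram.mem_iff_lt_colLen.mpr (by omega)))).2
    choose w hw using hheight
    have hker : ∀ c : Fin (μ.transpose.colLen 0), N (u c) = 0 := by
      intro c
      have hc : (c : ℕ) < μ.rowLen 0 :=
        lt_of_lt_of_eq c.2 (YoungDiagram.colLen_transpose μ 0)
      exact (huK 0 c hc).1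
    let v : JordanIndex μ.transpose → V := fun x =>
      (N ^ (μ.transpose.rowLen x.1 - 1 - x.2)) (w x.1)
    have h0 : ∀ x : JordanIndex μ.transpose, (N ^ (x.2 : ℕ)) (v x) = u x.1 := by
      intro x
      rw [← hw, ← Module.End.mul_apply, ← pow_add]
      congr 2
      omega
    have hli : LinearIndependent 𝕜 v := by
      refine linearIndependent_of_pow (N := N) (u := fun c => u c) ?_ h0 fun x i hi => ?_
      · exact hu.comp (fun c : Fin (μ.transpose.colLen 0) =>
          (⟨c, lt_of_lt_of_eq c.2 (YoungDiagram.colLen_transpose μ 0)⟩ : Fin (μ.rowLen 0)))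
          fun c c' hcc => Fin.ext (by simpa using hcc)
      · obtain ⟨t, rfl⟩ := Nat.exists_eq_add_of_lt hi
        rw [show (x.2 : ℕ) + t + 1 = t + 1 + x.2 by omega, pow_add, Module.End.mul_apply, h0,
          pow_succ,
          Module.End.mul_apply, hker, map_zero]
    have hcard : Fintype.card (JordanIndex μ.transpose) = finrank 𝕜 V := by
      rw [card_jordanIndex, hV]
      exact Finset.card_map _
    refine ⟨Basis.mk hli (hli.span_eq_top_of_card_eq_finrank' hcard).ge,
      (toMatrix_eq_jordanMatrix_iff _ N).mpr fun x => ?_⟩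
    rw [Basis.mk_apply]
    split_ifs with hx
    · rw [Basis.mk_apply]
      change N ((N ^ (μ.transpose.rowLen x.1 - 1 - x.2)) (w x.1)) =
        (N ^ (μ.transpose.rowLen x.1 - 1 - (x.2 - 1))) (w x.1)
      rw [← Module.End.mul_apply, ← pow_succ']
      congr 2
      omega
    · have h1 := h0 x
      rw [show (x.2 : ℕ) = 0 by omega, pow_zero, Module.End.one_apply] at h1
      rw [h1, hker]

theorem ker_restrict_pow [FiniteDimensional 𝕜 V] {N : Module.End 𝕜 V} {U : Submodule 𝕜 V}
    (h : ∀ v ∈ U, N v ∈ U) (i : ℕ) : finrank 𝕜 (LinearMap.ker ((N.restrict h) ^ i)) =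
      finrank 𝕜 (U ⊓ LinearMap.ker (N ^ i) : Submodule 𝕜 V) := by
  rw [← Submodule.finrank_map_subtype_eq, Module.End.pow_restrict, LinearMap.ker_restrict,
    Submodule.map_comap_subtype]

theorem hasJordanType_restrict_iff [FiniteDimensional 𝕜 V] {N : Module.End 𝕜 V}
    {U : Submodule 𝕜 V} (h : ∀ v ∈ U, N v ∈ U) {μ : YoungDiagram} (hU : finrank 𝕜 U = μ.card) :
    HasJordanType (N.restrict h) μ ↔ HasKernelType N U μ := by
  rw [hasJordanType_iff hU]
  exact forall_congr' fun i => by rw [ker_restrict_pow]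

end JordanType

/-! ### Tableaux as chains of horizontal strips -/

section Tableaux

theorem isHorizontalStrip_iff {μ lam : YoungDiagram} : IsHorizontalStrip μ lam ↔
    ∀ s c, ((s, c) ∈ μ → (s, c) ∈ lam) ∧ ((s + 1, c) ∈ lam → (s, c) ∈ μ) := by
  have key : ∀ x y : ℕ, x ≤ y ↔ ∀ c, c < x → c < y := fun x y =>
    ⟨fun h c hc => hc.trans_le h, fun h => by
      by_contra hxy
      exact lt_irrefl _ (h y (not_le.mp hxy))⟩
  simp only [IsHorizontalStrip, YoungDiagram.mem_iff_lt_rowLen, key (YoungDiagram.rowLen _ _)]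
  exact forall_congr' fun s => ⟨fun h c => ⟨h.1 c, h.2 c⟩,
    fun h => ⟨fun c => (h c).1, fun c => (h c).2⟩⟩

theorem youngDiagram_ext_rowLen {μ ν : YoungDiagram} (h : ∀ s, μ.rowLen s = ν.rowLen s) :
    μ = ν := by
  ext ⟨s, c⟩
  simp only [YoungDiagram.mem_cells, YoungDiagram.mem_iff_lt_rowLen, h]

theorem exists_youngDiagram {x : ℕ → ℕ} (hx : Antitone x) {L : ℕ} (hL : x L = 0) :
    ∃ μ : YoungDiagram, ∀ s, μ.rowLen s = x s := by
  let μ : YoungDiagram :=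
    { cells := (Finset.range L ×ˢ Finset.range (x 0)).filter fun c => c.2 < x c.1
      isLowerSet := by
        rintro ⟨s, c⟩ ⟨s', c'⟩ hle hmem
        obtain ⟨hs, hc⟩ := Prod.mk_le_mk.mp hle
        simp only [Finset.coe_filter, Finset.mem_product, Finset.mem_range,
          Set.mem_ofPred_eq] at hmem ⊢
        have := hx hs
        omega }
  have hmem : ∀ s c, (s, c) ∈ μ ↔ c < x s := by
    intro s c
    rw [← YoungDiagram.mem_cells]
    simp only [μ, Finset.mem_filter, Finset.mem_product, Finset.mem_range]
    refine ⟨fun h => h.2, fun h => ⟨⟨?_, h.trans_le (hx (Nat.zero_le s))⟩, h⟩⟩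
    by_contra hs
    have := hx (not_lt.mp hs)
    omega
  refine ⟨μ, fun s => ?_⟩
  have h1 : ∀ c, c < μ.rowLen s ↔ c < x s := fun c => by
    rw [← YoungDiagram.mem_iff_lt_rowLen, hmem]
  have h2 := h1 (μ.rowLen s)
  have h3 := h1 (x s)
  omega

variable {μ : YoungDiagram} (T : SemistandardYoungTableau μ)

theorem mem_subshape {j s c : ℕ} : (s, c) ∈ subshape T j ↔ (s, c) ∈ μ ∧ T s c < j := by
  rw [← YoungDiagram.mem_cells, subshape, Finset.mem_filter, YoungDiagram.mem_cells]

theorem subshape_zero : subshape T 0 = ⊥ := by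
  ext ⟨s, c⟩
  simp [mem_subshape]

theorem subshape_eq_of_lt {j : ℕ} (h : ∀ s c, (s, c) ∈ μ → T s c < j) : subshape T j = μ := by
  ext ⟨s, c⟩
  rw [YoungDiagram.mem_cells, YoungDiagram.mem_cells, mem_subshape]
  exact and_iff_left_of_imp (h s c)

theorem isHorizontalStrip_subshape (j : ℕ) :
    IsHorizontalStrip (subshape T j) (subshape T (j + 1)) := by
  refine isHorizontalStrip_iff.mpr fun s c => ?_
  simp only [mem_subshape]
  refine ⟨fun h => ⟨h.1, by omega⟩, fun h => ⟨μ.up_left_mem (Nat.le_succ s) le_rfl h.1, ?_⟩⟩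
  have : T s c < T (s + 1) c := T.col_strict (Nat.lt_succ_self s) h.1
  omega

theorem content_apply (e : ℕ) :
    content T e = (μ.cells.filter fun c => T c.1 c.2 = e).card := by
  rw [content, Finsupp.finsetSum_apply, Finset.card_filter]
  exact Finset.sum_congr rfl fun c _ => by rw [Finsupp.single_apply]

theorem card_subshape_succ (j : ℕ) :
    (subshape T (j + 1)).card = (subshape T j).card + content T j := by
  rw [content_apply, YoungDiagram.card, YoungDiagram.card, subshape, subshape,
    ← Finset.card_union_of_disjoint]
  · congr 1
    ext c
    simp only [Finset.mem_union, Finset.mem_filter]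
    rw [Nat.lt_succ_iff_lt_or_eq]
    tauto
  · rw [Finset.disjoint_filter]
    intro c _ h1 h2
    omega

theorem compExponent_apply {k : ℕ} (α : Fin k → ℕ) (e : ℕ) :
    compExponent α e = compPart α e := by
  rw [compExponent, Finsupp.finsetSum_apply]
  simp only [Finsupp.single_apply, compPart]
  split_ifs with h
  · rw [Finset.sum_eq_single ⟨e, h⟩]
    · simp
    · intro i _ hi
      exact if_neg fun h' => hi (Fin.ext h')
    · exact fun h => absurd (Finset.mem_univ _) h
  · refine Finset.sum_eq_zero fun i _ => if_neg ?_
    omega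

theorem lt_of_content_eq {k : ℕ} {α : Fin k → ℕ} (h : content T = compExponent α) {s c : ℕ}
    (hc : (s, c) ∈ μ) : T s c < k := by
  by_contra hlt
  have h1 : content T (T s c) = 0 := by
    rw [h, compExponent_apply, compPart, dif_neg hlt]
  rw [content_apply, Finset.card_eq_zero, Finset.filter_eq_empty_iff] at h1
  exact h1 ((YoungDiagram.mem_cells (s, c)).mpr hc) rfl

theorem subshape_of_content_eq {k : ℕ} {α : Fin k → ℕ} (h : content T = compExponent α) :
    subshape T k = μ :=
  subshape_eq_of_lt T fun _ _ => lt_of_content_eq T h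

theorem card_subshape_of_content_eq {k : ℕ} {α : Fin k → ℕ} (h : content T = compExponent α)
    (j : ℕ) : (subshape T j).card = ∑ i ∈ Finset.range j, compPart α i := by
  induction j with
  | zero => rw [subshape_zero]; rfl
  | succ j ih => rw [card_subshape_succ, ih, h, compExponent_apply, Finset.sum_range_succ]

theorem card_of_content_eq {k : ℕ} {α : Fin k → ℕ} (h : content T = compExponent α) :
    μ.card = ∑ i, α i := by
  rw [← sum_compPart_eq α, ← card_subshape_of_content_eq T h, subshape_of_content_eq T h]

theorem qBinomial_zero_right {q : ℝ} (hq : 0 < q) (a : ℕ) : qBinomial q a 0 = 1 := by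
  rw [qBinomial, qFactorial_zero, Nat.sub_zero, one_mul, div_self (qFactorial_pos hq a).ne']

/-- The definition cuts the product at the largest entry and the flag has k steps. Beyond either
bound all subshapes are μ, so the strip weights there are 1. -/
theorem qWeight_eq_prod {q : ℝ} (hq : 0 < q) {k : ℕ} (hT : ∀ s c, (s, c) ∈ μ → T s c < k) :
    qWeight q T = ∏ j ∈ Finset.range k, stripWeight q (subshape T j) (subshape T (j + 1)) := by
  have hstrip : ∀ j, stripWeight q (subshape T j) (subshape T (j + 1)) =
      ∏ i ∈ Finset.range (μ.colLen 0), qBinomial q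
        ((subshape T (j + 1)).rowLen i - (subshape T (j + 1)).rowLen (i + 1))
        ((subshape T (j + 1)).rowLen i - (subshape T j).rowLen i) := by
    intro j
    refine prod_range_colLen ?_ fun i hi => ?_
    · by_contra h
      have h1 := (mem_subshape T).mp (YoungDiagram.mem_iff_lt_rowLen.mpr (Nat.pos_of_ne_zero h))
      exact lt_irrefl _ (YoungDiagram.mem_iff_lt_colLen.mp h1.1)
    · rw [hi, Nat.zero_sub, Nat.zero_sub, qBinomial_zero_right hq]
  have hone : ∀ j, (∀ s c, (s, c) ∈ μ → T s c < j) →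
      stripWeight q (subshape T j) (subshape T (j + 1)) = 1 := by
    intro j hj
    rw [subshape_eq_of_lt T hj,
      subshape_eq_of_lt T fun s c h => (hj s c h).trans (Nat.lt_succ_self j)]
    exact Finset.prod_eq_one fun i _ => by rw [Nat.sub_self, qBinomial_zero_right hq]
  set M := μ.cells.sup (fun c => T c.1 c.2) + 1 with hMdef
  have hM : ∀ s c, (s, c) ∈ μ → T s c < M := fun s c h => Nat.lt_succ_iff.mpr
    (Finset.le_sup (f := fun c : ℕ × ℕ => T c.1 c.2) ((YoungDiagram.mem_cells (s, c)).mpr h))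
  have hext : ∀ K K', K ≤ K' → (∀ s c, (s, c) ∈ μ → T s c < K) →
      ∏ j ∈ Finset.range K, stripWeight q (subshape T j) (subshape T (j + 1)) =
        ∏ j ∈ Finset.range K', stripWeight q (subshape T j) (subshape T (j + 1)) := by
    intro K K' hKK hK
    refine Finset.prod_subset (Finset.range_mono hKK) fun j _ hj => hone j fun s c h => ?_
    exact (hK s c h).trans_le (by simpa using hj)
  rw [qWeight, Finset.prod_comm, ← hMdef]
  simp only [← hstrip]
  rcases le_total M k with h | h
  · exact hext M k h hM
  · exact (hext k M h hT).symm

/-- A chain of horizontal strips is the chain of subshapes of a semistandard tableau. -/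
theorem exists_tableau {ν : ℕ → YoungDiagram} (hν0 : ν 0 = ⊥) (k : ℕ)
    (h : ∀ i < k, IsHorizontalStrip (ν i) (ν (i + 1))) :
    ∃ T : SemistandardYoungTableau (ν k), (∀ j ≤ k, subshape T j = ν j) := by
  classical
  simp only [isHorizontalStrip_iff] at h
  have hmono : ∀ i j, i ≤ j → j ≤ k → ∀ c, c ∈ ν i → c ∈ ν j := by
    intro i j hij
    induction j, hij using Nat.le_induction with
    | base => exact fun _ _ h => h
    | succ j _ ih =>
      intro hj c hc
      exact (h j (by omega) c.1 c.2).1 (ih (by omega) c hc)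
  -- By monotonicity of the chain, the number of later diagrams missing a cell is the index at which
  -- the cell enters; outside the shape the value must be 0.
  let t : ℕ → ℕ → ℕ := fun s c =>
    if (s, c) ∈ ν k then ((Finset.range k).filter fun j => (s, c) ∉ ν (j + 1)).card else 0
  have ht : ∀ s c, (s, c) ∈ ν k → ∀ j ≤ k, (t s c < j ↔ (s, c) ∈ ν j) := by
    intro s c hc j hj
    have hts : t s c = ((Finset.range k).filter fun j => (s, c) ∉ ν (j + 1)).card := if_pos hc
    rw [hts]
    constructor
    · intro hlt
      by_contra hnot
      have hsub : Finset.range j ⊆ (Finset.range k).filter fun j => (s, c) ∉ ν (j + 1) := by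
        intro i hi
        rw [Finset.mem_range] at hi
        rw [Finset.mem_filter, Finset.mem_range]
        exact ⟨by omega, fun hmem => hnot (hmono (i + 1) j (by omega) hj _ hmem)⟩
      have := Finset.card_le_card hsub
      rw [Finset.card_range] at this
      omega
    · intro hmem
      rcases j with _ | j
      · rw [hν0] at hmem
        exact absurd hmem (YoungDiagram.notMem_bot _)
      · have hsub : ((Finset.range k).filter fun j => (s, c) ∉ ν (j + 1)) ⊆ Finset.range j := by
          intro i hi
          rw [Finset.mem_filter, Finset.mem_range] at hi
          rw [Finset.mem_range]
          by_contra hij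
          exact hi.2 (hmono (j + 1) (i + 1) (by omega) (by omega) _ hmem)
        have := Finset.card_le_card hsub
        rw [Finset.card_range] at this
        omega
  have hlt : ∀ s c, (s, c) ∈ ν k → t s c < k := fun s c hc => (ht s c hc k le_rfl).mpr hc
  let T : SemistandardYoungTableau (ν k) :=
    { entry := t
      row_weak' := by
        intro s c c' hcc hc'
        have hc : (s, c) ∈ ν k := (ν k).up_left_mem le_rfl hcc.le hc'
        have h1 := (ht s c' hc' (t s c' + 1) (hlt s c' hc')).mp (Nat.lt_succ_self _)
        have h2 := (ht s c hc (t s c' + 1) (hlt s c' hc')).mpr ((ν _).up_left_mem le_rfl hcc.le h1)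
        omega
      col_strict' := by
        intro s s' c hss hc'
        have hc : (s, c) ∈ ν k := (ν k).up_left_mem hss.le le_rfl hc'
        have h0 := hlt s' c hc'
        -- When a cell enters, the horizontal strip condition says that the cell above it was
        -- already present, so the entry above is strictly smaller.
        have h1 := (ht s' c hc' (t s' c + 1) h0).mp (Nat.lt_succ_self _)
        have h2 := (h (t s' c) h0 s c).2 ((ν _).up_left_mem hss le_rfl h1)
        exact (ht s c hc (t s' c) h0.le).mpr h2
      zeros' := by
        intro s c hc
        exact if_neg hc }
  refine ⟨T, fun j hj => ?_⟩
  ext ⟨s, c⟩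
  rw [YoungDiagram.mem_cells, YoungDiagram.mem_cells, mem_subshape]
  constructor
  · rintro ⟨h1, h2⟩
    exact (ht s c h1 j hj).mp h2
  · intro hmem
    have hk := hmono j k hj le_rfl _ hmem
    exact ⟨hk, (ht s c hk j hj).mpr hmem⟩

end Tableaux

/-! ### Socle layers and interlacing -/

section KernelShapes

variable {𝕜 : Type*} [Field 𝕜] {V : Type*} [AddCommGroup V] [Module 𝕜 V] [FiniteDimensional 𝕜 V]

/-- The socle layer `N ^ s (U ⊓ ker N ^ (s + 1))` of `N` on `U`. -/
def socleLayer (N : Module.End 𝕜 V) (U : Submodule 𝕜 V) (s : ℕ) : Submodule 𝕜 V :=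
  (U ⊓ LinearMap.ker (N ^ (s + 1))).map (N ^ s)

omit [FiniteDimensional 𝕜 V] in
theorem socleLayer_mono (N : Module.End 𝕜 V) {W U : Submodule 𝕜 V} (h : W ≤ U) (s : ℕ) :
    socleLayer N W s ≤ socleLayer N U s :=
  Submodule.map_mono (inf_le_inf_right _ h)

omit [FiniteDimensional 𝕜 V] in
-- N^(s+1) u = N^s (N u) with N u in W. Together with `socleLayer_mono` this is the interlacing that
-- makes consecutive types a horizontal strip; with W = U it shows that the layer dimensions
-- decrease.
theorem socleLayer_succ_le {N : Module.End 𝕜 V} {W U : Submodule 𝕜 V} (h : U.map N ≤ W) (s : ℕ) :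
    socleLayer N U (s + 1) ≤ socleLayer N W s := by
  rintro _ ⟨u, ⟨hu, hker⟩, rfl⟩
  refine ⟨N u, ⟨h (Submodule.mem_map_of_mem hu), ?_⟩, ?_⟩
  · rw [SetLike.mem_coe, LinearMap.mem_ker] at hker ⊢
    rwa [pow_succ, Module.End.mul_apply] at hker
  · rw [pow_succ, Module.End.mul_apply]

/-- On U ∩ ker N^(i+1) the map N^i has kernel U ∩ ker N^i, so the layers measure the successive
growth of the kernels. -/
theorem sum_finrank_socleLayer (N : Module.End 𝕜 V) (U : Submodule 𝕜 V) (i : ℕ) :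
    finrank 𝕜 (U ⊓ LinearMap.ker (N ^ i) : Submodule 𝕜 V) =
      ∑ s ∈ Finset.range i, finrank 𝕜 (socleLayer N U s) := by
  induction i with
  | zero => simp [Module.End.one_eq_id]
  | succ i ih =>
    rw [Finset.sum_range_succ, ← ih, ← finrank_map_add_finrank_inf_ker (N ^ i), inf_assoc,
      inf_eq_right.mpr (ker_pow_mono N (Nat.le_succ i)), add_comm]
    rfl

theorem exists_kernelShape {N : Module.End 𝕜 V} {U : Submodule 𝕜 V} (hU : U.map N ≤ U) {L : ℕ}
    (hL : N ^ L = 0) : ∃ μ : YoungDiagram, μ.card = finrank 𝕜 U ∧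
      ∀ s, μ.rowLen s = finrank 𝕜 (socleLayer N U s) := by
  have h0 : finrank 𝕜 (socleLayer N U L) = 0 := by
    rw [socleLayer, hL, Submodule.map_zero, finrank_bot]
  obtain ⟨μ, hμ⟩ := exists_youngDiagram (x := fun s => finrank 𝕜 (socleLayer N U s))
    (antitone_nat_of_succ_le fun s =>
    Submodule.finrank_mono (socleLayer_succ_le hU s)) h0
  refine ⟨μ, ?_, hμ⟩
  rw [← sum_rowLen_eq_card μ ((hμ L).trans h0), Finset.sum_congr rfl fun s _ => hμ s,
    ← sum_finrank_socleLayer, hL, LinearMap.ker_zero, inf_top_eq]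

theorem HasKernelType.rowLen_eq {N : Module.End 𝕜 V} {U : Submodule 𝕜 V} {μ : YoungDiagram}
    (h : HasKernelType N U μ) (s : ℕ) : μ.rowLen s = finrank 𝕜 (socleLayer N U s) := by
  have h1 := h (s + 1)
  have h2 := h s
  rw [sum_finrank_socleLayer, Finset.sum_range_succ, Finset.sum_range_succ,
    ← sum_finrank_socleLayer, h2] at h1
  omega

theorem hasKernelType_of_rowLen_eq {N : Module.End 𝕜 V} {U : Submodule 𝕜 V} {μ : YoungDiagram}
    (h : ∀ s, μ.rowLen s = finrank 𝕜 (socleLayer N U s)) : HasKernelType N U μ := fun i => by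
  rw [sum_finrank_socleLayer, Finset.sum_congr rfl fun s _ => h s]

end KernelShapes

/-! ### Points of the quiver variety as pairs (F, N) -/

section QuiverVarieties

variable {𝕜 : Type*} [Field 𝕜] {n k : ℕ} {α : Fin k → ℕ}

/-- The steps of a partial flag as a sequence, constant from the last step on. -/
def PartialFlag.step (F : PartialFlag 𝕜 n α) (i : ℕ) : Submodule 𝕜 (Fin n → 𝕜) :=
  F.space ⟨min i k, by omega⟩

theorem PartialFlag.step_mono (F : PartialFlag 𝕜 n α) : Monotone F.step :=
  fun i j h => F.mono (by simp only [Fin.mk_le_mk]; omega)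

theorem PartialFlag.step_eq (F : PartialFlag 𝕜 n α) (i : Fin (k + 1)) : F.step i = F.space i := by
  rw [PartialFlag.step]
  congr 1
  ext
  simp only
  omega

theorem PartialFlag.finrank_step (F : PartialFlag 𝕜 n α) {i : ℕ} (hi : i ≤ k) :
    finrank 𝕜 (F.step i) = ∑ j ∈ Finset.range i, compPart α j := by
  rw [PartialFlag.step, F.finrank_space, sum_compPart α hi]
  simp only [min_eq_left hi]

theorem PartialFlag.step_zero (F : PartialFlag 𝕜 n α) : F.step 0 = ⊥ :=
  Submodule.finrank_eq_zero.mp (by rw [F.finrank_step (Nat.zero_le k), Finset.sum_range_zero])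

theorem PartialFlag.step_top (F : PartialFlag 𝕜 n α) (hα : ∑ i, α i = n) : F.step k = ⊤ :=
  Submodule.eq_top_of_finrank_eq (by
    rw [F.finrank_step le_rfl, sum_compPart_eq, hα, finrank_fin_fun])

theorem strictlyCompatible_iff {F : PartialFlag 𝕜 n α} {N : Module.End 𝕜 (Fin n → 𝕜)} :
    StrictlyCompatible F N ↔ ∀ i < k, (F.step (i + 1)).map N ≤ F.step i := by
  have key : ∀ i : Fin k, (∀ v ∈ F.space i.succ, N v ∈ F.space i.castSucc) ↔
      (F.step (i + 1)).map N ≤ F.step i := by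
    intro i
    rw [Submodule.map_le_iff_le_comap, ← F.step_eq i.succ, ← F.step_eq i.castSucc]
    rfl
  constructor
  · intro h i hi
    exact (key ⟨i, hi⟩).mp (h ⟨i, hi⟩)
  · intro h i
    exact (key i).mpr (h i i.2)

theorem hasJordanTableau_iff {F : PartialFlag 𝕜 n α} {N : Module.End 𝕜 (Fin n → 𝕜)}
    (h : StrictlyCompatible F N) {μ : YoungDiagram} {T : SemistandardYoungTableau μ}
    (hT : content T = compExponent α) :
    HasJordanTableau h T ↔ ∀ i < k, HasKernelType N (F.step (i + 1)) (subshape T (i + 1)) := by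
  have key : ∀ i : Fin k, HasJordanType (N.restrict (h.mapsTo i)) (subshape T (i + 1)) ↔
      HasKernelType N (F.step (i + 1)) (subshape T (i + 1)) := by
    intro i
    rw [hasJordanType_restrict_iff, ← F.step_eq i.succ]
    · rfl
    · rw [← F.step_eq, card_subshape_of_content_eq T hT]
      exact F.finrank_step i.2
  constructor
  · intro h i hi
    exact (key ⟨i, hi⟩).mp (h ⟨i, hi⟩)
  · intro h i
    exact (key i).mpr (h i i.2)

theorem exists_hasJordanTableau_iff {F : PartialFlag 𝕜 n α} {N : Module.End 𝕜 (Fin n → 𝕜)}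
    {μ : YoungDiagram} {T : SemistandardYoungTableau μ} (hT : content T = compExponent α) :
    (∃ h : StrictlyCompatible F N, HasJordanTableau h T) ↔
      IsAdapted F.step (subshape T) k N := by
  constructor
  · rintro ⟨h, hJ⟩ i hi
    exact ⟨strictlyCompatible_iff.mp h i hi, (hasJordanTableau_iff h hT).mp hJ i hi⟩
  · intro h
    have hs := strictlyCompatible_iff.mpr fun i hi => (h i hi).1
    exact ⟨hs, (hasJordanTableau_iff hs hT).mpr fun i hi => (h i hi).2⟩

theorem StrictlyCompatible.map_step_le {F : PartialFlag 𝕜 n α} {N : Module.End 𝕜 (Fin n → 𝕜)}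
    (h : StrictlyCompatible F N) {i : ℕ} (hi : i ≤ k) : (F.step i).map N ≤ F.step i := by
  rcases i with _ | i
  · simp [F.step_zero]
  · exact (strictlyCompatible_iff.mp h i (by omega)).trans (F.step_mono (Nat.le_succ i))

theorem StrictlyCompatible.pow_eq_zero {F : PartialFlag 𝕜 n α} {N : Module.End 𝕜 (Fin n → 𝕜)}
    (h : StrictlyCompatible F N) (hα : ∑ i, α i = n) : N ^ k = 0 := by
  have key : ∀ i ≤ k, ∀ v ∈ F.step i, (N ^ i) v = 0 := by
    intro i
    induction i with
    | zero =>
      intro _ v hv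
      rw [F.step_zero] at hv
      rw [(Submodule.mem_bot 𝕜).mp hv, map_zero]
    | succ i ih =>
      intro hi v hv
      rw [pow_succ, Module.End.mul_apply]
      exact ih (by omega) _ (strictlyCompatible_iff.mp h i hi (Submodule.mem_map_of_mem hv))
  refine LinearMap.ext fun v => key k le_rfl v ?_
  rw [F.step_top hα]
  exact Submodule.mem_top

/-- The kernel shapes of N on the steps interlace, so they form the subshapes of a tableau; its
content is α because the sizes of the shapes are the dimensions of the steps. -/
theorem exists_isAdapted {F : PartialFlag 𝕜 n α} {N : Module.End 𝕜 (Fin n → 𝕜)}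
    (h : StrictlyCompatible F N) (hα : ∑ i, α i = n) :
    ∃ (μ : YoungDiagram) (T : SemistandardYoungTableau μ), content T = compExponent α ∧
      IsAdapted F.step (subshape T) k N := by
  have hN := h.pow_eq_zero hα
  have hex : ∀ i, ∃ μ : YoungDiagram, i ≤ k → μ.card = finrank 𝕜 (F.step i) ∧
      ∀ s, μ.rowLen s = finrank 𝕜 (socleLayer N (F.step i) s) := by
    intro i
    by_cases hi : i ≤ k
    · obtain ⟨μ, hμ⟩ := exists_kernelShape (h.map_step_le hi) hN
      exact ⟨μ, fun _ => hμ⟩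
    · exact ⟨⊥, fun h => absurd h hi⟩
  choose ν hν using hex
  have hν0 : ν 0 = ⊥ := by
    refine youngDiagram_ext_rowLen fun s => ?_
    rw [(hν 0 (Nat.zero_le k)).2 s, F.step_zero, rowLen_bot, socleLayer, bot_inf_eq,
      Submodule.map_bot, finrank_bot]
  obtain ⟨T, hT⟩ := exists_tableau hν0 k fun i hi s => by
    rw [(hν i hi.le).2, (hν (i + 1) hi).2, (hν (i + 1) hi).2]
    exact ⟨Submodule.finrank_mono (socleLayer_mono N (F.step_mono (Nat.le_succ i)) s),
      Submodule.finrank_mono (socleLayer_succ_le (strictlyCompatible_iff.mp h i hi) s)⟩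
  refine ⟨ν k, T, ?_, fun i hi => ⟨strictlyCompatible_iff.mp h i hi, ?_⟩⟩
  · ext e
    rw [compExponent_apply]
    by_cases he : e < k
    · have h1 := card_subshape_succ T e
      rw [hT e he.le, hT (e + 1) he, (hν e he.le).1, (hν (e + 1) he).1, F.finrank_step he.le,
        F.finrank_step he, Finset.sum_range_succ] at h1
      omega
    · rw [compPart, dif_neg he, content_apply, Finset.card_eq_zero, Finset.filter_eq_empty_iff]
      rintro ⟨s, c⟩ hc
      have h1 : (s, c) ∈ subshape T k := by
        rw [hT k le_rfl]
        exact (YoungDiagram.mem_cells _).mp hc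
      have h2 := ((mem_subshape T).mp h1).2
      simp only
      omega
  · rw [hT (i + 1) hi]
    exact hasKernelType_of_rowLen_eq (hν (i + 1) hi).2

/-- Socle layers determine the row lengths of all subshapes, and an entry is recovered from the
first subshape containing its cell. -/
theorem isAdapted_unique {F : PartialFlag 𝕜 n α} {N : Module.End 𝕜 (Fin n → 𝕜)}
    {μ μ' : YoungDiagram} {T : SemistandardYoungTableau μ} {T' : SemistandardYoungTableau μ'}
    (hT : content T = compExponent α) (hT' : content T' = compExponent α)
    (h : IsAdapted F.step (subshape T) k N) (h' : IsAdapted F.step (subshape T') k N) :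
    (⟨μ, T⟩ : (μ : YoungDiagram) × SemistandardYoungTableau μ) = ⟨μ', T'⟩ := by
  have hsub : ∀ i ≤ k, subshape T i = subshape T' i := by
    intro i hi
    rcases i with _ | i
    · rw [subshape_zero, subshape_zero]
    · refine youngDiagram_ext_rowLen fun s => ?_
      rw [(h i hi).2.rowLen_eq, (h' i hi).2.rowLen_eq]
  have hμ : μ = μ' := by
    rw [← subshape_of_content_eq T hT, hsub k le_rfl, subshape_of_content_eq T' hT']
  subst hμ
  congr 1
  ext s c
  by_cases hc : (s, c) ∈ μ
  · have hlt : ∀ j ≤ k, (T s c < j ↔ T' s c < j) := by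
      intro j hj
      have h1 : (s, c) ∈ subshape T j ↔ (s, c) ∈ subshape T' j := by rw [hsub j hj]
      simpa only [mem_subshape, hc, true_and] using h1
    have h1 := lt_of_content_eq T hT hc
    have h2 := lt_of_content_eq T' hT' hc
    have h3 := (hlt (T s c + 1) h1).mp (Nat.lt_succ_self _)
    have h4 := (hlt (T' s c + 1) h2).mpr (Nat.lt_succ_self _)
    omega
  · rw [T.zeros hc, T'.zeros hc]

/-- The vertices carry every step of the flag except F_0 = 0, and the reverse arrow out of vertex 0
is N on the whole space. -/
theorem quiverPoint_injective (hα : ∑ i, α i = n) {F F' : PartialFlag 𝕜 n α}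
    {N N' : Module.End 𝕜 (Fin n → 𝕜)} {h : StrictlyCompatible F N}
    {h' : StrictlyCompatible F' N'} (heq : quiverPoint F N h = quiverPoint F' N' h') :
    F = F' ∧ N = N' := by
  have hF : F = F' := by
    refine PartialFlag.ext (funext fun i => ?_)
    by_cases hi : (i : ℕ) = 0
    · have h1 := F.step_zero
      have h2 := F'.step_zero
      have h3 : i = 0 := Fin.ext hi
      rw [h3]
      exact ((F.step_eq 0).symm.trans (h1.trans h2.symm)).trans (F'.step_eq 0)
    · have h1 := congrFun (congrArg DoublePathRep.space heq) ⟨k - i, by omega⟩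
      have h2 : flagIndex (⟨k - i, by omega⟩ : Fin k) = i := by
        ext
        simp only [flagIndex]
        omega
      simp only [quiverPoint, h2] at h1
      exact h1
  refine ⟨hF, ?_⟩
  subst hF
  have htop := F.step_top hα
  -- An arrow at vertex 0 exists only for at least two vertices. For k = 0 the space is zero, and
  -- for k = 1 compatibility forces N = 0.
  rcases k with _ | _ | k
  · have h1 := h.pow_eq_zero hα
    have h2 : ∀ v : Fin n → 𝕜, v = 0 := fun v => LinearMap.congr_fun h1 v
    exact LinearMap.ext fun v => (h2 _).trans (h2 _).symm
  · rw [← pow_one N, ← pow_one N']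
    exact (h.pow_eq_zero hα).trans (h'.pow_eq_zero hα).symm
  · have h1 : (quiverPoint F N h).revArrow = (quiverPoint F N' h').revArrow := by
      simp only [quiverPoint, DoublePathRep.mk.injEq, heq_eq_eq, true_and] at heq ⊢
      exact heq
    have h2 := congrFun (congrFun (congrFun h1 (1 : Fin (k + 2))) (0 : Fin (k + 2))) rfl
    have hv : ∀ v, v ∈ F.space (flagIndex (0 : Fin (k + 2))) := by
      intro v
      have h3 : F.space (flagIndex (0 : Fin (k + 2))) = ⊤ := by
        rw [← htop, ← F.step_eq]
        rfl
      rw [h3]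
      exact Submodule.mem_top
    exact LinearMap.ext fun v => congrArg Subtype.val (LinearMap.congr_fun h2 ⟨v, hv v⟩)

theorem natCard_isAdapted_tableau [Finite 𝕜] {q : ℝ} (hq : q⁻¹ = Nat.card 𝕜) (hα : ∑ i, α i = n)
    {μ : YoungDiagram} {T : SemistandardYoungTableau μ} (hT : content T = compExponent α)
    (F : PartialFlag 𝕜 n α) :
    (Nat.card {N : Module.End 𝕜 (Fin n → 𝕜) // IsAdapted F.step (subshape T) k N} : ℝ) =
      typeFactor q μ * (∏ i, qFactorial q (α i)) * qWeight q T := by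
  have hQ1 : (1 : ℝ) < q⁻¹ := by rw [hq]; exact_mod_cast Finite.one_lt_card
  have hQ : 0 < q⁻¹ := by linarith
  have hq0 : 0 < q := inv_pos.mp hQ
  have hq1 : q < 1 := (one_lt_inv₀ hq0).mp hQ1
  have hcount := natCard_isAdapted F.step_mono F.step_zero (subshape_zero T) k
    (fun i hi => by rw [F.finrank_step hi, card_subshape_of_content_eq T hT])
    (fun i _ => isHorizontalStrip_subshape T i)
  rw [← hq, prod_extensionCount hq0 hq1 (subshape_zero T) k
    fun i _ => isHorizontalStrip_subshape T i, subshape_of_content_eq T hT,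
    card_of_content_eq T hT, hα, finrank_fin_fun, mul_comm] at hcount
  rw [mul_left_cancel₀ (pow_pos hQ _).ne' hcount, qWeight_eq_prod T hq0 fun s c =>
    lt_of_content_eq T hT, Finset.prod_range]
  congr 2
  refine Finset.prod_congr rfl fun i _ => ?_
  rw [card_subshape_succ, Nat.add_sub_cancel_left, hT, compExponent_apply, compPart_fin]

/-- Since n² - n = 2 (n choose 2), the power q^(-n² + n) splits evenly: one half comes from
`typeFactor`, the other from the flag count. -/
theorem prefactor_eq {q : ℝ} (hq0 : 0 < q) {μ : YoungDiagram} (hμ : μ.card = n) :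
    prefactor q n α μ * q ^ n.choose 2 = q ^ nStatComp α * qFactorial q n * typeFactor q μ := by
  have hexp : (-(n : ℤ) ^ 2 + n + nStat μ + nStatComp α) =
      ((nStat μ + nStatComp α : ℕ) : ℤ) - ((n.choose 2 + n.choose 2 : ℕ) : ℤ) := by
    have h := choose_two_mul_two_add n
    have h' : (2 : ℤ) * n.choose 2 + n = n * n := by exact_mod_cast h
    push_cast
    linarith
  have hexp' : ((n : ℤ) - μ.rowLen 0) = ((n - μ.rowLen 0 : ℕ) : ℤ) := by
    have := rowLen_le_card μ 0
    push_cast [hμ ▸ this]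
    rfl
  have hD : ∏ i ∈ Finset.range (μ.colLen 0), qFactorial q (μ.rowLen i - μ.rowLen (i + 1)) ≠ 0 :=
    (Finset.prod_pos fun i _ => qFactorial_pos hq0 _).ne'
  rw [prefactor, typeFactor, hexp, hexp', zpow_sub₀ hq0.ne', zpow_natCast, zpow_natCast,
    zpow_natCast, hμ, pow_add, pow_add]
  field_simp

theorem ncard_quiverVarietyTableau [Finite 𝕜] {q : ℝ} (hq : q⁻¹ = Nat.card 𝕜)
    (hα : ∑ i, α i = n) {μ : YoungDiagram} {T : SemistandardYoungTableau μ}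
    (hT : content T = compExponent α) :
    ((quiverVarietyTableau 𝕜 n α T).ncard : ℝ) = prefactor q n α μ * qWeight q T := by
  have hQ : (0 : ℝ) < q⁻¹ := by rw [hq]; exact_mod_cast Nat.card_pos
  have hq0 : 0 < q := inv_pos.mp hQ
  have hfin := finite_partialFlag (𝕜 := 𝕜) n α
  have hfin' := finite_linearMap (𝕜 := 𝕜) (C := Fin n → 𝕜) (V := Fin n → 𝕜)
  have hcard : (quiverVarietyTableau 𝕜 n α T).ncard =
      Nat.card {x : PartialFlag 𝕜 n α × Module.End 𝕜 (Fin n → 𝕜) //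
        IsAdapted x.1.step (subshape T) k x.2} := by
    symm
    have hJ := fun x : {x : PartialFlag 𝕜 n α × Module.End 𝕜 (Fin n → 𝕜) //
      IsAdapted x.1.step (subshape T) k x.2} => (exists_hasJordanTableau_iff hT).mpr x.2
    refine Nat.card_congr (Equiv.ofBijective (β := quiverVarietyTableau 𝕜 n α T)
      (fun x => ⟨quiverPoint x.1.1 x.1.2 (hJ x).1, x.1.1, x.1.2, (hJ x).1, rfl, (hJ x).2⟩) ⟨?_, ?_⟩)
    · intro x x' heq
      obtain ⟨h1, h2⟩ := quiverPoint_injective (h := (hJ x).1) (h' := (hJ x').1) hα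
        (Subtype.ext_iff.mp heq)
      exact Subtype.ext (Prod.ext h1 h2)
    · rintro ⟨V, F, N, h, rfl, hJ⟩
      exact ⟨⟨(F, N), (exists_hasJordanTableau_iff hT).mp ⟨h, hJ⟩⟩, rfl⟩
  rw [hcard, natCard_subtype_eq_mul Prod.fst (P := fun _ => True)
    (c := typeFactor q μ * (∏ i, qFactorial q (α i)) * qWeight q T) (fun _ _ => trivial)]
  · have h1 := natCard_partialFlag hq n α hα
    have h2 := prefactor_eq (α := α) hq0 ((card_of_content_eq T hT).trans hα)
    have h3 : q ^ n.choose 2 ≠ 0 := (pow_pos hq0 _).ne'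
    rw [Nat.card_congr (Equiv.subtypeUnivEquiv fun _ => trivial)]
    apply mul_right_cancel₀ h3
    linear_combination (typeFactor q μ * qWeight q T) * h1 - qWeight q T * h2
  · intro F _
    rw [← natCard_isAdapted_tableau hq hα hT F]
    congr 1
    exact Nat.card_congr
      { toFun := fun x => ⟨x.1.2, Eq.subst (motive := fun F' : PartialFlag 𝕜 n α =>
          IsAdapted F'.step (subshape T) k x.1.2) x.2.2 x.2.1⟩
        invFun := fun N => ⟨(F, N.1), N.2, rfl⟩
        left_inv := by
          rintro ⟨⟨F', N⟩, hx, rfl⟩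
          rfl
        right_inv := fun _ => rfl }

theorem finite_quiverVariety [Finite 𝕜] : (quiverVariety 𝕜 n α).Finite := by
  have hfin := finite_partialFlag (𝕜 := 𝕜) n α
  have hfin' := finite_linearMap (𝕜 := 𝕜) (C := Fin n → 𝕜) (V := Fin n → 𝕜)
  refine (Set.finite_range (fun x : {x : PartialFlag 𝕜 n α × Module.End 𝕜 (Fin n → 𝕜) //
    StrictlyCompatible x.1 x.2} => quiverPoint x.1.1 x.1.2 x.2)).subset ?_
  rintro V ⟨F, N, h, rfl⟩
  exact ⟨⟨(F, N), h⟩, rfl⟩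

theorem quiverVarietyTableau_subset {μ : YoungDiagram} (T : SemistandardYoungTableau μ) :
    quiverVarietyTableau 𝕜 n α T ⊆ quiverVariety 𝕜 n α := by
  rintro V ⟨F, N, h, rfl, -⟩
  exact ⟨F, N, h, rfl⟩

/-- The pieces indexed by tableaux of content α cover the variety by `exists_isAdapted` and are
disjoint by `isAdapted_unique`. -/
theorem ncard_quiverVariety [Finite 𝕜] (hα : ∑ i, α i = n) :
    (quiverVariety 𝕜 n α).ncard = ∑ μ ∈ partitionsOf n,
      ∑ T ∈ (finite_setOf_content_eq μ (compExponent α)).toFinset,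
        (quiverVarietyTableau 𝕜 n α T).ncard := by
  classical
  set S := (partitionsOf n).sigma
    fun μ => (finite_setOf_content_eq μ (compExponent α)).toFinset with hS
  have hmem : ∀ x : (μ : YoungDiagram) × SemistandardYoungTableau μ,
      x ∈ S ↔ content x.2 = compExponent α := by
    rintro ⟨μ, T⟩
    simp only [hS, Finset.mem_sigma, partitionsOf, Set.Finite.mem_toFinset, Set.mem_ofPred_eq,
      and_iff_right_iff_imp]
    exact fun hT => (card_of_content_eq T hT).trans hα
  clear_value S
  have hunion : quiverVariety 𝕜 n α =
      ⋃ x ∈ (S : Set ((μ : YoungDiagram) × SemistandardYoungTableau μ)),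
        quiverVarietyTableau 𝕜 n α x.2 := by
    refine Set.Subset.antisymm ?_ (Set.iUnion₂_subset fun x _ => quiverVarietyTableau_subset x.2)
    rintro V ⟨F, N, h, rfl⟩
    obtain ⟨μ, T, hT, hA⟩ := exists_isAdapted h hα
    obtain ⟨h', hJ⟩ := (exists_hasJordanTableau_iff hT).mpr hA
    refine Set.mem_iUnion₂.mpr ⟨⟨μ, T⟩, Finset.mem_coe.mpr ((hmem ⟨μ, T⟩).mpr hT), ?_⟩
    exact ⟨F, N, h', rfl, hJ⟩
  rw [hunion, Set.Finite.ncard_biUnion S.finite_toSet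
    (fun x _ => finite_quiverVariety.subset (quiverVarietyTableau_subset x.2)),
    finsum_mem_coe_finset, hS, Finset.sum_sigma]
  rintro ⟨μ, T⟩ hT ⟨μ', T'⟩ hT' hne
  have hT := (hmem _).mp (Finset.mem_coe.mp hT)
  have hT' := (hmem _).mp (Finset.mem_coe.mp hT')
  refine Set.disjoint_left.mpr ?_
  rintro V ⟨F, N, h, rfl, hJ⟩ ⟨F', N', h', heq, hJ'⟩
  obtain ⟨rfl, rfl⟩ := quiverPoint_injective hα heq
  exact hne (isAdapted_unique hT hT' ((exists_hasJordanTableau_iff hT).mp ⟨h, hJ⟩)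
    ((exists_hasJordanTableau_iff hT').mp ⟨h', hJ'⟩))

end QuiverVarieties
end QWhittaker

theorem theorem8p6 {𝕜 : Type*} [Field 𝕜] [Finite 𝕜] (q : ℝ) (hq : 1 / q = (Nat.card 𝕜 : ℝ))
    (n k : ℕ) (α : Fin k → ℕ) (hα : ∑ i, α i = n) :
    (∀ (μ : YoungDiagram) (T : SemistandardYoungTableau μ),
      QWhittaker.content T = QWhittaker.compExponent α →
        ((QWhittaker.quiverVarietyTableau 𝕜 n α T).ncard : ℝ) =
          QWhittaker.prefactor q n α μ * QWhittaker.qWeight q T) ∧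
    ((QWhittaker.quiverVariety 𝕜 n α).ncard : ℝ) =
      ∑ μ ∈ QWhittaker.partitionsOf n,
        QWhittaker.prefactor q n α μ *
          MvPowerSeries.coeff (QWhittaker.compExponent α) (QWhittaker.qWhittaker q μ) := by
  rw [one_div] at hq
  refine ⟨fun μ T hT => QWhittaker.ncard_quiverVarietyTableau hq hα hT, ?_⟩
  rw [QWhittaker.ncard_quiverVariety hα]
  push_cast
  refine Finset.sum_congr rfl fun μ _ => ?_
  rw [MvPowerSeries.coeff_apply, QWhittaker.qWhittaker, Finset.mul_sum]
  refine Finset.sum_congr rfl fun T hT => ?_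
  exact QWhittaker.ncard_quiverVarietyTableau hq hα (by simpa using hT)
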